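/- **Theorem.** Let $\alpha,\beta\in\mathbb C\setminus\{-1,-2,-3,\dots\}$ and let $p$ be a polynomial with complex coefficients. *Finite part.* For $a\notin\{0,-1,-2,\dots\}$, $\xi>0$ and $h(t)=\sum_{n\ge 0}h_nt^n$ analytic on the closed disk $|t|\le\xi$, the Hadamard finite part of $\int_0^\xi t^{a-1}h(t)\,dt$ is $\mathrm{f.p.}\!\int_0^\xi t^{a-1}h(t)\,dt:=\xi^{a}\sum_{n\ge0}\frac{h_n}{n+a}\,\xi^{n}$. For $g$ analytic on $[0,1]$ put $$\mathrm{f.p.}\!\int_0^1 t^\alpha(1-t)^\beta g(t)\,dt:=\mathrm{f.p.}\!\int_0^{\xi_0}t^\alpha(1-t)^\beta g(t)\,dt+\int_{\xi_0}^{\xi_1}t^\alpha(1-t)^\beta g(t)\,dt+\mathrm{f.p.}\!\int_0^{1-\xi_1}s^\beta(1-s)^\alpha g(1-s)\,ds ,$$ where $0<\xi_0\le\xi_1<1$ are any numbers such that $g$ is analytic on the closed disks $|t|\le\xi_0$ and $|1-t|\le1-\xi_1$. For $z\in\mathbb C\setminus[0,1]$ let $$\mathcal C_{\alpha,\beta}[p](z)=\frac1{2\pi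 i}\;\mathrm{f.p.}\!\int_0^1\frac{t^\alpha(1-t)^\beta p(t)}{t-z}\,dt .$$ *Riemann–Hilbert problem.* Find $f$ such that 1. $f$ is analytic on $\mathbb C\setminus[0,1]$, and for every $x\in(0,1)$ the limits $f^\pm(x)=\lim_{z\to x,\ \pm\operatorname{Im}z>0}f(z)$ exist and satisfy $f^+(x)=f^-(x)+x^\alpha(1-x)^\beta p(x)$; 2. $f(z)=O(z^{-1})$ as $z\to\infty$; 3. there is $f_0$ analytic at $0$ with $f(z)-z^\alpha f_0(z)=O(1)$ as $z\to0$, $z\notin[0,1]$; 4. there is $f_1$ analytic at $1$ with $f(z)-(1-z)^\beta f_1(z)=O(1)$ as $z\to1$, $z\notin[0,1]$. Here $z^\alpha$ and $(1-z)^\beta$ are branches analytic off $[0,1]$ near the respective endpoint, namely those with $0<\arg z<2\pi$ and $0<\arg(1-z)<2\pi$ (another such choice only multiplies by a constant). Then the finite part in $\mathcal C_{\alpha,\beta}[p](z)$ does not depend on the choice of $\xi_0,\xi_1$ for any $z\in\mathbb C\setminus[0,1]$, and the problem has at most one solution. Assume moreover that $p(0)=0$ if $\alpha=0$, and that $p(1)=0$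 if $\beta=0$. Then $f=\mathcal C_{\alpha,\beta}[p]$ is a solution, hence the unique one. -/

import Mathlib

namespace JacobiRH

open Filter Topology Asymptotics

/-- The interval `[0,1]` as a subset of the complex plane. -/
def unitCut : Set ℂ := Complex.ofReal '' Set.Icc (0 : ℝ) 1

/-- The Taylor coefficient of order `n` at `0` of a function analytic at `0`. -/
noncomputable def taylorCoeffZero (f : ℂ → ℂ) (n : ℕ) : ℂ :=
  iteratedDeriv n f 0 / (n.factorial : ℂ)

/-- The Hadamard finite part of `∫₀^ξ t ^ (a - 1) * f t dt`, for `a ∉ {0, -1, -2, …}`, `ξ > 0` and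
`f` analytic on the closed disk of radius `ξ` at `0`: if `f t = ∑ fₙ tⁿ`, it is
`ξ ^ a * ∑ fₙ / (n + a) * ξ ^ n`. -/
noncomputable def finitePartZero (a : ℂ) (f : ℂ → ℂ) (ξ : ℝ) : ℂ :=
  (ξ : ℂ) ^ a * ∑' n : ℕ, taylorCoeffZero f n / ((n : ℂ) + a) * (ξ : ℂ) ^ n

/-- Admissible splitting points for a function `g` analytic on `[0,1]`. -/
structure IsSplitting (g : ℂ → ℂ) (ξ₀ ξ₁ : ℝ) : Prop where
  pos : 0 < ξ₀
  le : ξ₀ ≤ ξ₁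
  lt_one : ξ₁ < 1
  analytic_zero : AnalyticOnNhd ℂ g (Metric.closedBall 0 ξ₀)
  analytic_one : AnalyticOnNhd ℂ g (Metric.closedBall 1 (1 - ξ₁))

/-- The finite part of `∫₀¹ t ^ α * (1 - t) ^ β * g t dt` computed with splitting points `ξ₀`, `ξ₁`:
finite part on `[0, ξ₀]`, ordinary integral on `[ξ₀, ξ₁]`, and finite part on `[ξ₁, 1]`, the latter
carried to the origin by the substitution `s = 1 - t`. -/
noncomputable def splitFinitePart (α β : ℂ) (g : ℂ → ℂ) (ξ₀ ξ₁ : ℝ) : ℂ :=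
  finitePartZero (α + 1) (fun t => (1 - t) ^ β * g t) ξ₀
    + (∫ t in ξ₀..ξ₁, (t : ℂ) ^ α * (1 - (t : ℂ)) ^ β * g (t : ℂ))
    + finitePartZero (β + 1) (fun s => (1 - s) ^ α * g (1 - s)) (1 - ξ₁)

/-- `g` is analytic on `[0,1]` and every admissible splitting gives the value `I` for the finite
part of `∫₀¹ t ^ α * (1 - t) ^ β * g t dt`. -/
structure IsFinitePart (α β : ℂ) (g : ℂ → ℂ) (I : ℂ) : Prop where
  analytic : AnalyticOnNhd ℂ g unitCut
  exists_splitting : ∃ ξ₀ ξ₁ : ℝ, IsSplitting g ξ₀ ξ₁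
  eq_split : ∀ ξ₀ ξ₁ : ℝ, IsSplitting g ξ₀ ξ₁ → splitFinitePart α β g ξ₀ ξ₁ = I

open Classical in
/-- The Hadamard finite part of `∫₀¹ t ^ α * (1 - t) ^ β * g t dt`
(and `0` if this is not well defined). -/
noncomputable def finitePart (α β : ℂ) (g : ℂ → ℂ) : ℂ :=
  if h : ∃ I : ℂ, IsFinitePart α β g I then h.choose else 0

/-- The integrand of the Cauchy transform, without the weight `t ^ α * (1 - t) ^ β`. -/
noncomputable def cauchyKernel (p : Polynomial ℂ) (z : ℂ) : ℂ → ℂ :=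
  fun t => p.eval t / (t - z)

/-- The finite-part Cauchy transform of `t ^ α * (1 - t) ^ β * p t` over `[0,1]`. -/
noncomputable def cauchyTransform (α β : ℂ) (p : Polynomial ℂ) (z : ℂ) : ℂ :=
  1 / (2 * (Real.pi : ℂ) * Complex.I) * finitePart α β (cauchyKernel p z)

/-- The branch of `w ^ a` with `0 < arg w < 2π`, analytic on `ℂ ∖ [0, ∞)`. -/
noncomputable def cutPow (a w : ℂ) : ℂ :=
  Complex.exp (a * (Complex.log (-w) + (Real.pi : ℂ) * Complex.I))

/-- `f` solves the scalar Riemann-Hilbert problem on `(0,1)`. Only the values of `f` off `[0,1]`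
matter. The powers of `z` and of `1 - z` are analytic off `[0,1]` near the respective endpoint;
another such branch differs by a constant factor, which the analytic germ absorbs. -/
structure IsSolution (α β : ℂ) (p : Polynomial ℂ) (f : ℂ → ℂ) : Prop where
  analytic : AnalyticOnNhd ℂ f unitCutᶜ
  jump : ∀ x : ℝ, 0 < x → x < 1 → ∃ fPlus fMinus : ℂ,
    Tendsto f (𝓝[{z : ℂ | 0 < z.im}] (x : ℂ)) (𝓝 fPlus) ∧
    Tendsto f (𝓝[{z : ℂ | z.im < 0}] (x : ℂ)) (𝓝 fMinus) ∧
    fPlus = fMinus + (x : ℂ) ^ α * (1 - (x : ℂ)) ^ β * p.eval (x : ℂ)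
  at_infinity : f =O[Bornology.cobounded ℂ] (fun z : ℂ => z⁻¹)
  at_zero : ∃ f₀ : ℂ → ℂ, AnalyticAt ℂ f₀ 0 ∧
    (fun z => f z - cutPow α z * f₀ z) =O[𝓝[unitCutᶜ] (0 : ℂ)] (fun _ => (1 : ℝ))
  at_one : ∃ f₁ : ℂ → ℂ, AnalyticAt ℂ f₁ 1 ∧
    (fun z => f z - cutPow β (1 - z) * f₁ z) =O[𝓝[unitCutᶜ] (1 : ℂ)] (fun _ => (1 : ℝ))

end JacobiRH

namespace JacobiRH

open Filter Topology Asymptotics Metric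

/-! Existence. If `u` solves `a u + t u' = g` with `u` analytic at 0, then `t ^ a * u t` is a
primitive of `t ^ (a - 1) * g t`, and the finite part is its value at the upper limit. Thus finite
parts add over adjacent intervals, obey integration by parts with no contribution from 0, and are
bounded by the sup norm of `g` on a slightly larger set. The splitting points are therefore
immaterial, and the Cauchy transform is a difference of two one-endpoint transforms, one for each
endpoint, meeting at an arbitrary `b` in `(0,1)`. The sup-norm bound gives analyticity off the cut
and decay at infinity; the jump is Plemelj's formula on a segment away from the endpoints.

At the endpoint 0 the transform of the density 1 satisfies a first-order equation
(`hasDerivAt_halfTransform_one`), so it is a multiple of `z ^ α` plus a particular solution. The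
latter is analytic unless `α` is a natural number `m`, when a term `z ^ m * log (-z)` appears. A
general density `h` changes this only by the factor `h z` and a bounded error
(`exists_norm_halfTransform_sub_le`). The logarithmic term stays bounded for `m ≥ 1`, and for `m =
0` because `h 0 = 0`. The endpoint 1 follows by `t ↦ 1 - t`.

Uniqueness. The difference of two solutions has no jump, hence extends analytically to `ℂ ∖ {0, 1}`
by Painlevé's theorem. Near 0 it is `z ^ α * h z + O(1)`, but it is single-valued. Comparing the two
sides of the cut, where `z ^ α` differs by the factor `exp (2πiα)`, shows that it is bounded along
the cut: if the factor is not 1, subtract; if it is 1, `α` is a natural number. Growth is at most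
polynomial, so 0 is at worst a pole, and boundedness along one ray excludes a pole
(`exists_tendsto_of_sub_cutPow_isBigO`). The same holds at 1, and Liouville's theorem concludes. No
vanishing of `p` is needed here. -/

/-! ### Finite parts at the origin and the Euler equation -/

lemma exists_analyticOnNhd_closedBall_gt {g : ℂ → ℂ} {ξ : ℝ} (hξ : 0 ≤ ξ)
    (hg : AnalyticOnNhd ℂ g (closedBall 0 ξ)) :
    ∃ ρ, ξ < ρ ∧ AnalyticOnNhd ℂ g (closedBall 0 ρ) := by
  obtain ⟨δ, hδ, h⟩ := (isCompact_closedBall (0 : ℂ) ξ).exists_cthickening_subset_open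
    (isOpen_analyticAt ℂ g) hg
  rw [cthickening_closedBall hδ.le hξ] at h
  exact ⟨δ + ξ, by linarith, fun z hz => h hz⟩

lemma exists_norm_le_closedBall {g : ℂ → ℂ} {ρ : ℝ}
    (hg : AnalyticOnNhd ℂ g (closedBall 0 ρ)) : ∃ C, ∀ t ∈ closedBall (0 : ℂ) ρ, ‖g t‖ ≤ C :=
  (isCompact_closedBall (0 : ℂ) ρ).exists_bound_of_continuousOn hg.continuousOn

lemma norm_taylorCoeffZero_le {g : ℂ → ℂ} {ρ C : ℝ} (hρ : 0 < ρ)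
    (hg : AnalyticOnNhd ℂ g (closedBall 0 ρ)) (hC : ∀ t ∈ closedBall (0 : ℂ) ρ, ‖g t‖ ≤ C) (n : ℕ) :
    ‖taylorCoeffZero g n‖ ≤ C / ρ ^ n := by
  have h := Complex.norm_iteratedDeriv_le_of_forall_mem_sphere_norm_le (f := g) (c := 0) n hρ
    (DifferentiableOn.diffContOnCl (by
      rw [closure_ball _ hρ.ne']; exact hg.differentiableOn))
    (fun z hz => hC z (sphere_subset_closedBall hz))
  have hn : (0 : ℝ) < n.factorial := by positivity
  rw [taylorCoeffZero, norm_div, Complex.norm_natCast, div_le_iff₀ hn]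
  calc _ ≤ _ := h
    _ = _ := by ring

lemma exists_norm_inv_nat_add_le (a : ℂ) : ∃ K, 0 < K ∧ ∀ n : ℕ, ‖((n : ℂ) + a)⁻¹‖ ≤ K := by
  have h1 : Tendsto (fun n : ℕ => ((n : ℂ) + a)⁻¹) atTop (𝓝 0) := by
    apply tendsto_inv₀_cobounded.comp
    have h2 : Tendsto (fun n : ℕ => (n : ℂ)) atTop (Bornology.cobounded ℂ) := by
      rw [← tendsto_norm_atTop_iff_cobounded]
      simpa using tendsto_natCast_atTop_atTop (R := ℝ)
    exact (tendsto_add_const_cobounded a).comp h2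
  obtain ⟨K, hK, h⟩ := (Metric.isBounded_range_of_tendsto _ h1).exists_pos_norm_le
  exact ⟨K, hK, fun n => h _ ⟨n, rfl⟩⟩

lemma hasSum_taylorCoeffZero {g : ℂ → ℂ} {ρ : ℝ} (hg : AnalyticOnNhd ℂ g (closedBall 0 ρ))
    {z : ℂ} (hz : ‖z‖ < ρ) : HasSum (fun n => taylorCoeffZero g n * z ^ n) (g z) := by
  have h := Complex.hasSum_taylorSeries_on_ball
    (hg.differentiableOn.mono ball_subset_closedBall) (z := z) (by simpa using hz)
  convert! h using 2 with n
  simp [taylorCoeffZero]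
  ring

/-- The solution `u` of `a * u + z * u' = g` which is analytic at `0`. -/
noncomputable def eulerSolution (a : ℂ) (g : ℂ → ℂ) (z : ℂ) : ℂ :=
  ∑' n : ℕ, taylorCoeffZero g n / ((n : ℂ) + a) * z ^ n

lemma finitePartZero_eq (a : ℂ) (g : ℂ → ℂ) (ξ : ℝ) :
    finitePartZero a g ξ = (ξ : ℂ) ^ a * eulerSolution a g ξ := rfl

lemma summable_eulerSolution (a : ℂ) {g : ℂ → ℂ} {ρ : ℝ}
    (hg : AnalyticOnNhd ℂ g (closedBall 0 ρ)) {z : ℂ} (hz : ‖z‖ < ρ) :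
    Summable (fun n : ℕ => taylorCoeffZero g n / ((n : ℂ) + a) * z ^ n) := by
  have hρ : 0 < ρ := (norm_nonneg z).trans_lt hz
  obtain ⟨C, hC⟩ := exists_norm_le_closedBall hg
  obtain ⟨K, hK, h⟩ := exists_norm_inv_nat_add_le a
  have hq : ‖z‖ / ρ < 1 := (div_lt_one hρ).2 hz
  refine Summable.of_norm_bounded
    ((summable_geometric_of_lt_one (by positivity) hq).mul_left (C * K)) fun n => ?_
  have h1 := norm_taylorCoeffZero_le hρ hg hC n
  rw [div_eq_mul_inv, norm_mul, norm_mul, norm_pow]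
  calc _ ≤ C / ρ ^ n * K * ‖z‖ ^ n := by
        gcongr
        · exact (norm_nonneg _).trans h1
        · exact h n
    _ = _ := by rw [div_pow]; ring

lemma norm_eulerSolution_le (a : ℂ) {r ρ : ℝ} (hr : 0 ≤ r) (hρ : r < ρ) :
    ∃ K, 0 ≤ K ∧ ∀ (g : ℂ → ℂ) (C : ℝ), AnalyticOnNhd ℂ g (closedBall 0 ρ) →
      (∀ t ∈ closedBall (0 : ℂ) ρ, ‖g t‖ ≤ C) → ∀ z : ℂ, ‖z‖ ≤ r → ‖eulerSolution a g z‖ ≤ K * C := by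
  have hρ0 : 0 < ρ := hr.trans_lt hρ
  obtain ⟨K, hK, h⟩ := exists_norm_inv_nat_add_le a
  have hq : r / ρ < 1 := (div_lt_one hρ0).2 hρ
  refine ⟨K * (1 - r / ρ)⁻¹, mul_nonneg hK.le (inv_nonneg.2 (by linarith)),
    fun g C hg hC z hz => ?_⟩
  have h2 := (hasSum_geometric_of_lt_one (div_nonneg hr hρ0.le) hq).mul_left (C * K)
  refine (tsum_of_norm_bounded h2 fun n => ?_).trans (le_of_eq (by ring))
  have h1 := norm_taylorCoeffZero_le hρ0 hg hC n
  rw [div_eq_mul_inv, norm_mul, norm_mul, norm_pow]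
  calc _ ≤ C / ρ ^ n * K * r ^ n := by
        gcongr
        · exact mul_nonneg ((norm_nonneg _).trans h1) hK.le
        · exact (norm_nonneg _).trans h1
        · exact h n
    _ = _ := by rw [div_pow]; ring

/-- Substitute for the estimate of an integral by the integral of the modulus: Cauchy's bounds on a
disk of radius `ρ > ξ` make the defining series geometric. That `K` does not depend on `g` is what
later gives estimates uniform in `z`. -/
lemma norm_finitePartZero_le (a : ℂ) {ξ ρ : ℝ} (hξ : 0 ≤ ξ) (hρ : ξ < ρ) :
    ∃ K, 0 ≤ K ∧ ∀ (g : ℂ → ℂ) (C : ℝ), AnalyticOnNhd ℂ g (closedBall 0 ρ) →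
      (∀ t ∈ closedBall (0 : ℂ) ρ, ‖g t‖ ≤ C) → ‖finitePartZero a g ξ‖ ≤ K * C := by
  obtain ⟨K, hK, h⟩ := norm_eulerSolution_le a hξ hρ
  refine ⟨‖(ξ : ℂ) ^ a‖ * K, by positivity, fun g C hg hC => ?_⟩
  rw [finitePartZero_eq, norm_mul, mul_assoc]
  gcongr
  exact h g C hg hC ξ (by simp [abs_of_nonneg hξ])

lemma taylorCoeffZero_congr {f g : ℂ → ℂ} (h : f =ᶠ[𝓝 0] g) (n : ℕ) :
    taylorCoeffZero f n = taylorCoeffZero g n := by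
  rw [taylorCoeffZero, taylorCoeffZero, h.iteratedDeriv_eq]

lemma finitePartZero_congr (a : ℂ) {f g : ℂ → ℂ} (h : f =ᶠ[𝓝 0] g) (ξ : ℝ) :
    finitePartZero a f ξ = finitePartZero a g ξ := by
  simp only [finitePartZero, taylorCoeffZero_congr h]

lemma taylorCoeffZero_add {f g : ℂ → ℂ} (hf : AnalyticAt ℂ f 0) (hg : AnalyticAt ℂ g 0) (n : ℕ) :
    taylorCoeffZero (fun t => f t + g t) n = taylorCoeffZero f n + taylorCoeffZero g n := by
  have := iteratedDeriv_add (n := n) hf.contDiffAt hg.contDiffAt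
  rw [taylorCoeffZero, taylorCoeffZero, taylorCoeffZero, ← add_div, ← this]
  rfl

lemma taylorCoeffZero_const_mul (c : ℂ) (f : ℂ → ℂ) (n : ℕ) :
    taylorCoeffZero (fun t => c * f t) n = c * taylorCoeffZero f n := by
  rw [taylorCoeffZero, taylorCoeffZero, iteratedDeriv_const_mul_field, mul_div_assoc]

lemma finitePartZero_const_mul (a c : ℂ) (f : ℂ → ℂ) (ξ : ℝ) :
    finitePartZero a (fun t => c * f t) ξ = c * finitePartZero a f ξ := by
  simp only [finitePartZero, taylorCoeffZero_const_mul, mul_div_assoc, mul_assoc, tsum_mul_left]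
  ring

lemma finitePartZero_add (a : ℂ) {f g : ℂ → ℂ} {ξ : ℝ} (hξ : 0 ≤ ξ)
    (hf : AnalyticOnNhd ℂ f (closedBall 0 ξ)) (hg : AnalyticOnNhd ℂ g (closedBall 0 ξ)) :
    finitePartZero a (fun t => f t + g t) ξ = finitePartZero a f ξ + finitePartZero a g ξ := by
  have h0 : (0 : ℂ) ∈ closedBall (0 : ℂ) ξ := by simpa using hξ
  obtain ⟨ρ, hρ, hf'⟩ := exists_analyticOnNhd_closedBall_gt hξ hf
  obtain ⟨ρ', hρ', hg'⟩ := exists_analyticOnNhd_closedBall_gt hξ hg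
  have hn : ‖(ξ : ℂ)‖ = ξ := by simp [abs_of_nonneg hξ]
  have h1 := summable_eulerSolution a hf' (z := ξ) (by rwa [hn])
  have h2 := summable_eulerSolution a hg' (z := ξ) (by rwa [hn])
  simp only [finitePartZero, taylorCoeffZero_add (hf 0 h0) (hg 0 h0), add_div, add_mul]
  rw [h1.tsum_add h2, mul_add]

lemma taylorCoeffZero_id_mul_deriv {g : ℂ → ℂ} (hg : AnalyticAt ℂ g 0) (n : ℕ) :
    taylorCoeffZero (fun t => t * deriv g t) n = n * taylorCoeffZero g n := by
  rw [taylorCoeffZero, taylorCoeffZero,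
    iteratedDeriv_fun_mul (f := fun t => t) contDiffAt_id hg.deriv.contDiffAt]
  cases n with
  | zero => simp
  | succ m =>
    rw [Finset.sum_eq_single 1]
    · simp [iteratedDeriv_succ', iteratedDeriv_fun_id]
      ring
    · intro i _ hi
      simp only [iteratedDeriv_fun_id, hi]
      simp
    · simp

/-- The Taylor coefficients of `a g + t g'` are `(n + a) gₙ`, which cancel the denominators. This is
the finite part of the derivative of `t ^ a * g t`: the boundary term at 0 is discarded. -/
lemma finitePartZero_euler {a : ℂ} (ha : ∀ n : ℕ, (n : ℂ) + a ≠ 0) {g : ℂ → ℂ} {ξ : ℝ} (hξ : 0 ≤ ξ)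
    (hg : AnalyticOnNhd ℂ g (closedBall 0 ξ)) :
    finitePartZero a (fun t => a * g t + t * deriv g t) ξ = (ξ : ℂ) ^ a * g ξ := by
  have h0 := hg 0 (by simpa using hξ)
  obtain ⟨ρ, hρ, hg'⟩ := exists_analyticOnNhd_closedBall_gt hξ hg
  have hs := hasSum_taylorCoeffZero hg' (z := ξ) (by simpa [abs_of_nonneg hξ] using hρ)
  rw [finitePartZero, ← hs.tsum_eq]
  congr 2
  ext n
  rw [taylorCoeffZero_add (f := fun t => a * g t) (g := fun t => t * deriv g t)
    (analyticAt_const.mul h0) (analyticAt_id.mul h0.deriv),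
    taylorCoeffZero_const_mul, taylorCoeffZero_id_mul_deriv h0]
  have := ha n
  field_simp
  ring

lemma summable_geometric_pred {q : ℝ} (h0 : 0 ≤ q) (h1 : q < 1) :
    Summable (fun n : ℕ => q ^ (n - 1)) := by
  rw [← summable_nat_add_iff 1]
  simpa using summable_geometric_of_lt_one h0 h1

/-- Termwise differentiation. A resonance `n + a = 0` is allowed when the corresponding coefficient
of `g` vanishes; this case yields the logarithmic solutions later. -/
lemma hasDerivAt_eulerSolution {a : ℂ} {g : ℂ → ℂ} {ρ : ℝ}
    (hg : AnalyticOnNhd ℂ g (closedBall 0 ρ))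
    (ha : ∀ n : ℕ, (n : ℂ) + a = 0 → taylorCoeffZero g n = 0) {z : ℂ} (hz : ‖z‖ < ρ) :
    ∃ d, HasDerivAt (eulerSolution a g) d z ∧ a * eulerSolution a g z + z * d = g z := by
  obtain ⟨r, hzr, hrρ⟩ := exists_between hz
  have hr : 0 < r := (norm_nonneg z).trans_lt hzr
  have hρ : 0 < ρ := hr.trans hrρ
  obtain ⟨C, hC⟩ := exists_norm_le_closedBall hg
  obtain ⟨K, hK, h⟩ := exists_norm_inv_nat_add_le a
  have hC0 : 0 ≤ C := (norm_nonneg _).trans (hC 0 (by simpa using hρ.le))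
  set c : ℕ → ℂ := fun n => taylorCoeffZero g n / ((n : ℂ) + a) with hc
  -- At a resonant index division by zero makes `c n = 0`, so the recursion `(n + a) cₙ = gₙ` still
  -- holds.
  have hca : ∀ n : ℕ, c n * n = taylorCoeffZero g n - a * c n := fun n => by
    by_cases hn : (n : ℂ) + a = 0
    · simp [hc, ha n hn]
    · simp only [hc]; field_simp; ring
  have hcn : ∀ n : ℕ, ‖c n * n‖ ≤ C * (1 + ‖a‖ * K) / ρ ^ n := fun n => by
    have h1 := norm_taylorCoeffZero_le hρ hg hC n
    rw [hca]
    calc _ ≤ ‖taylorCoeffZero g n‖ + ‖a * c n‖ := norm_sub_le _ _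
      _ ≤ C / ρ ^ n + ‖a‖ * (C / ρ ^ n * K) := by
        rw [norm_mul, hc]
        simp only [div_eq_mul_inv (taylorCoeffZero g n), norm_mul]
        gcongr
        exact h n
      _ = _ := by ring
  have hd := hasDerivAt_tsum_of_isPreconnected (𝕜 := ℂ) (F := ℂ) (t := ball (0 : ℂ) r)
    (g := fun n z => c n * z ^ n) (g' := fun n z => c n * (n * z ^ (n - 1)))
    (u := fun n => C * (1 + ‖a‖ * K) / ρ * (r / ρ) ^ (n - 1)) (y₀ := z) (y := z)
    ((summable_geometric_pred (by positivity) ((div_lt_one hρ).2 hrρ)).mul_left _)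
    isOpen_ball (convex_ball _ _).isPreconnected
    (fun n y _ => (hasDerivAt_pow n y).const_mul (c n)) (fun n y hy => by
      have hy' : ‖y‖ ≤ r := by simpa using (mem_ball.1 hy).le
      cases n with
      | zero => simp; positivity
      | succ m =>
        rw [← mul_assoc, norm_mul, norm_pow, Nat.add_sub_cancel]
        calc _ ≤ C * (1 + ‖a‖ * K) / ρ ^ (m + 1) * r ^ m := by
              gcongr
              · exact hcn (m + 1)
          _ = _ := by rw [div_pow, pow_succ]; field_simp) (by simpa using hzr)
    (summable_eulerSolution a hg hz) (by simpa using hzr)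
  refine ⟨_, hd, ?_⟩
  have h1 := (summable_eulerSolution a hg hz).tsum_mul_left a
  have hs := hasSum_taylorCoeffZero hg hz
  have h3 : ∀ n : ℕ, z * (c n * (n * z ^ (n - 1))) =
      taylorCoeffZero g n * z ^ n - a * (c n * z ^ n) := fun n => by
    rcases n with _ | m
    · have := hca 0
      rw [Nat.cast_zero, mul_zero] at this
      rw [Nat.cast_zero, pow_zero, zero_mul, mul_zero, mul_zero]
      linear_combination this
    · have := hca (m + 1)
      rw [Nat.add_sub_cancel]
      linear_combination (z ^ (m + 1)) * this
  rw [← tsum_mul_left, tsum_congr h3,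
    hs.summable.tsum_sub ((summable_eulerSolution a hg hz).mul_left a), hs.tsum_eq, h1,
    eulerSolution]
  ring

/-- By the Euler equation, `t ^ a * eulerSolution a g t` has derivative `t ^ (a - 1) * g t` for `t >
0`; the fundamental theorem of calculus applies. -/
lemma finitePartZero_sub {a : ℂ} (ha : ∀ n : ℕ, (n : ℂ) + a ≠ 0) {g : ℂ → ℂ} {ξ : ℝ}
    (hg : AnalyticOnNhd ℂ g (closedBall 0 ξ)) {x y : ℝ} (hx : 0 < x) (hy : 0 < y) (hxξ : x ≤ ξ)
    (hyξ : y ≤ ξ) :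
    finitePartZero a g y - finitePartZero a g x = ∫ t in x..y, (t : ℂ) ^ (a - 1) * g t := by
  have ha0 : a ≠ 0 := by simpa using ha 0
  obtain ⟨ρ, hρ, hg'⟩ := exists_analyticOnNhd_closedBall_gt (hx.le.trans hxξ) hg
  have hmem : ∀ t ∈ Set.uIcc x y, 0 < t ∧ t ≤ ξ := fun t ht =>
    ⟨(lt_min hx hy).trans_le ht.1, ht.2.trans (max_le hxξ hyξ)⟩
  have hcont : ContinuousOn (fun t : ℝ => (t : ℂ) ^ (a - 1) * g t) (Set.uIcc x y) := by
    intro t ht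
    obtain ⟨h0, h1⟩ := hmem t ht
    have h2 : ContinuousAt (fun t : ℝ => (t : ℂ) ^ (a - 1)) t :=
      Complex.continuousAt_ofReal_cpow_const _ _ (Or.inr h0.ne')
    have h3 : ContinuousAt (fun t : ℝ => g t) t :=
      ContinuousAt.comp (f := fun t : ℝ => (t : ℂ)) (g := g)
        (hg t (by simpa [abs_of_pos h0] using h1)).continuousAt Complex.continuous_ofReal.continuousAt
    exact (h2.mul h3).continuousWithinAt
  refine (intervalIntegral.integral_eq_sub_of_hasDerivAt (fun t ht => ?_)
    hcont.intervalIntegrable).symm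
  obtain ⟨h0, h1⟩ := hmem t ht
  have ht0 : (t : ℂ) ≠ 0 := by exact_mod_cast h0.ne'
  obtain ⟨d, hd, he⟩ := hasDerivAt_eulerSolution (a := a) hg' (fun n hn => absurd hn (ha n))
    (z := t) (by simpa [abs_of_pos h0] using h1.trans_lt hρ)
  have h4 := (hasDerivAt_ofReal_cpow_const h0.ne' ha0).mul hd.comp_ofReal
  refine h4.congr_deriv ?_
  rw [← he, Complex.cpow_sub _ _ ht0, Complex.cpow_one]
  field_simp

/-! ### Finite parts over a segment with a movable splitting point -/

/-- The finite part of `∫₀^b t ^ (a - 1) * g t dt`, split at `ε`. -/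
noncomputable def fpTo (a : ℂ) (g : ℂ → ℂ) (ε b : ℝ) : ℂ :=
  finitePartZero a g ε + ∫ t in ε..b, (t : ℂ) ^ (a - 1) * g t

/-- A closed disk of radius `ε` around `0` together with the segment `[0, b]`. -/
def diskSegment (ε b : ℝ) : Set ℂ := closedBall 0 ε ∪ Complex.ofReal '' Set.Icc 0 b

lemma isCompact_diskSegment (ε b : ℝ) : IsCompact (diskSegment ε b) :=
  (isCompact_closedBall _ _).union (isCompact_Icc.image Complex.continuous_ofReal)

lemma diskSegment_mono {ε ε' b b' : ℝ} (h : ε ≤ ε') (hb : b ≤ b') :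
    diskSegment ε b ⊆ diskSegment ε' b' :=
  Set.union_subset_union (closedBall_subset_closedBall h)
    (Set.image_mono (Set.Icc_subset_Icc_right hb))

lemma closedBall_subset_diskSegment (ε b : ℝ) : closedBall 0 ε ⊆ diskSegment ε b :=
  Set.subset_union_left

lemma mem_diskSegment_of_mem_uIcc {ε b : ℝ} (hε : 0 < ε) (hb : 0 < b) {t : ℝ}
    (ht : t ∈ Set.uIcc ε b) : 0 < t ∧ (t : ℂ) ∈ diskSegment ε b := by
  have h0 : 0 < t := (lt_min hε hb).trans_le ht.1
  refine ⟨h0, ?_⟩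
  rcases le_max_iff.1 ht.2 with h | h
  · exact Or.inl (by simpa [abs_of_pos h0] using h)
  · exact Or.inr ⟨t, ⟨h0.le, h⟩, rfl⟩

lemma continuousOn_cpow_uIcc (a : ℂ) {ε b : ℝ} (hε : 0 < ε) (hb : 0 < b) :
    ContinuousOn (fun t : ℝ => (t : ℂ) ^ a) (Set.uIcc ε b) := fun _ ht =>
  (Complex.continuousAt_ofReal_cpow_const _ _
    (Or.inr (mem_diskSegment_of_mem_uIcc hε hb ht).1.ne')).continuousWithinAt

lemma continuousOn_cpow_mul (a : ℂ) {g : ℂ → ℂ} {ε b : ℝ} (hε : 0 < ε) (hb : 0 < b)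
    (hg : AnalyticOnNhd ℂ g (diskSegment ε b)) :
    ContinuousOn (fun t : ℝ => (t : ℂ) ^ a * g t) (Set.uIcc ε b) :=
  (continuousOn_cpow_uIcc a hε hb).mul (hg.continuousOn.comp Complex.continuous_ofReal.continuousOn
    fun _ ht => (mem_diskSegment_of_mem_uIcc hε hb ht).2)

lemma fpTo_self (a : ℂ) (g : ℂ → ℂ) (b : ℝ) : fpTo a g b b = finitePartZero a g b := by
  simp [fpTo]

lemma fpTo_congr (a : ℂ) {f g : ℂ → ℂ} {ε b : ℝ} (h : f =ᶠ[𝓝 0] g)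
    (h' : ∀ t ∈ Set.uIcc ε b, f t = g t) : fpTo a f ε b = fpTo a g ε b := by
  rw [fpTo, fpTo, finitePartZero_congr a h]
  congr 1
  exact intervalIntegral.integral_congr fun t ht => by simp only [h' t ht]

lemma fpTo_congr_set (a : ℂ) {f g : ℂ → ℂ} {ε b : ℝ} (hε : 0 < ε) (hb : 0 < b)
    (h : ∀ t ∈ diskSegment ε b, f t = g t) : fpTo a f ε b = fpTo a g ε b := by
  refine fpTo_congr a ?_ fun t ht => h t (mem_diskSegment_of_mem_uIcc hε hb ht).2
  filter_upwards [closedBall_mem_nhds (0 : ℂ) hε] with t ht using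
    h t (closedBall_subset_diskSegment _ _ ht)

lemma fpTo_const_mul (a c : ℂ) (g : ℂ → ℂ) (ε b : ℝ) :
    fpTo a (fun t => c * g t) ε b = c * fpTo a g ε b := by
  rw [fpTo, fpTo, finitePartZero_const_mul, mul_add, ← intervalIntegral.integral_const_mul]
  simp only [mul_left_comm]

lemma fpTo_add (a : ℂ) {f g : ℂ → ℂ} {ε b : ℝ} (hε : 0 < ε) (hb : 0 < b)
    (hf : AnalyticOnNhd ℂ f (diskSegment ε b)) (hg : AnalyticOnNhd ℂ g (diskSegment ε b)) :
    fpTo a (fun t => f t + g t) ε b = fpTo a f ε b + fpTo a g ε b := by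
  rw [fpTo, fpTo, fpTo, finitePartZero_add a hε.le
    (hf.mono (closedBall_subset_diskSegment _ _)) (hg.mono (closedBall_subset_diskSegment _ _))]
  simp only [mul_add]
  rw [intervalIntegral.integral_add
    (continuousOn_cpow_mul (a - 1) hε hb hf).intervalIntegrable
    (continuousOn_cpow_mul (a - 1) hε hb hg).intervalIntegrable]
  ring

lemma fpTo_sub (a : ℂ) {f g : ℂ → ℂ} {ε b : ℝ} (hε : 0 < ε) (hb : 0 < b)
    (hf : AnalyticOnNhd ℂ f (diskSegment ε b)) (hg : AnalyticOnNhd ℂ g (diskSegment ε b)) :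
    fpTo a (fun t => f t - g t) ε b = fpTo a f ε b - fpTo a g ε b := by
  have h1 := fpTo_add a hε hb hf (g := fun t => -1 * g t) (analyticOnNhd_const.mul hg)
  rw [fpTo_const_mul] at h1
  simpa [sub_eq_add_neg] using h1

/-- The finite part is a bounded functional for the sup norm. Differentiation in `z`, decay at
infinity and the endpoint estimate all rest on it. -/
lemma norm_fpTo_le (a : ℂ) {ε ρ b : ℝ} (hε : 0 < ε) (hρ : ε < ρ) (hb : 0 < b) :
    ∃ K, 0 ≤ K ∧ ∀ (g : ℂ → ℂ) (C : ℝ), AnalyticOnNhd ℂ g (diskSegment ρ b) →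
      (∀ t ∈ diskSegment ρ b, ‖g t‖ ≤ C) → ‖fpTo a g ε b‖ ≤ K * C := by
  obtain ⟨K, hK, h⟩ := norm_finitePartZero_le a hε.le hρ
  obtain ⟨M, hM⟩ := isCompact_uIcc.exists_bound_of_continuousOn
    (continuousOn_cpow_uIcc (a - 1) hε hb)
  have hM0 : 0 ≤ M := (norm_nonneg _).trans (hM ε Set.left_mem_uIcc)
  refine ⟨K + M * |b - ε|, by positivity, fun g C hg hC => ?_⟩
  have h1 := h g C (hg.mono (closedBall_subset_diskSegment _ _))
    fun t ht => hC t (closedBall_subset_diskSegment _ _ ht)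
  have h2 : ‖∫ t in ε..b, (t : ℂ) ^ (a - 1) * g t‖ ≤ M * C * |b - ε| := by
    refine intervalIntegral.norm_integral_le_of_norm_le_const fun t ht => ?_
    have ht' := Set.uIoc_subset_uIcc ht
    rw [norm_mul]
    gcongr
    · exact hM t ht'
    · exact hC t (diskSegment_mono hρ.le le_rfl (mem_diskSegment_of_mem_uIcc hε hb ht').2)
  calc _ ≤ _ := norm_add_le _ _
    _ ≤ K * C + M * C * |b - ε| := add_le_add h1 h2
    _ = _ := by ring

lemma fpTo_split_eq {a : ℂ} (ha : ∀ n : ℕ, (n : ℂ) + a ≠ 0) {g : ℂ → ℂ} {ε ε' b : ℝ} (hε : 0 < ε)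
    (hεε' : ε ≤ ε') (hb : 0 < b) (hg : AnalyticOnNhd ℂ g (diskSegment ε' b)) :
    fpTo a g ε b = fpTo a g ε' b := by
  have hε' := hε.trans_le hεε'
  have h1 := finitePartZero_sub ha (hg.mono (closedBall_subset_diskSegment _ _)) hε hε' hεε' le_rfl
  have h2 := (continuousOn_cpow_mul (a - 1) hε hε' (g := g)
    (hg.mono (Set.union_subset (closedBall_subset_closedBall hεε' |>.trans
      (closedBall_subset_diskSegment _ _)) ?_))).intervalIntegrable (μ := MeasureTheory.volume)
  · have h3 := (continuousOn_cpow_mul (a - 1) hε' hb hg).intervalIntegrable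
      (μ := MeasureTheory.volume)
    rw [fpTo, fpTo, ← intervalIntegral.integral_add_adjacent_intervals h2 h3, ← h1]
    ring
  · rintro _ ⟨t, ht, rfl⟩
    exact Or.inl (by simpa [abs_of_nonneg ht.1] using ht.2)

lemma fpTo_split_eq' {a : ℂ} (ha : ∀ n : ℕ, (n : ℂ) + a ≠ 0) {g : ℂ → ℂ} {ε ε' b : ℝ} (hε : 0 < ε)
    (hε' : 0 < ε') (hb : 0 < b) (hg : AnalyticOnNhd ℂ g (diskSegment ε b))
    (hg' : AnalyticOnNhd ℂ g (diskSegment ε' b)) : fpTo a g ε b = fpTo a g ε' b := by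
  rcases le_total ε ε' with h | h
  · exact fpTo_split_eq ha hε h hb hg'
  · exact (fpTo_split_eq ha hε' h hb hg).symm

/-- Integration by parts for finite parts: the contribution of `ε` from the disk cancels that from
the segment, and 0 contributes nothing. -/
lemma fpTo_euler {a : ℂ} (ha : ∀ n : ℕ, (n : ℂ) + a ≠ 0) {g : ℂ → ℂ} {ε b : ℝ} (hε : 0 < ε)
    (hb : 0 < b) (hg : AnalyticOnNhd ℂ g (diskSegment ε b)) :
    fpTo a (fun t => a * g t + t * deriv g t) ε b = (b : ℂ) ^ a * g b := by
  have ha0 : a ≠ 0 := by simpa using ha 0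
  have hc := (continuousOn_cpow_mul (a - 1) hε hb (g := fun t => a * g t + t * deriv g t)
    ((analyticOnNhd_const.mul hg).add (analyticOnNhd_id.mul hg.deriv))).intervalIntegrable
    (μ := MeasureTheory.volume)
  have hd : ∀ t ∈ Set.uIcc ε b, HasDerivAt (fun t : ℝ => (t : ℂ) ^ a * g t)
      ((t : ℂ) ^ (a - 1) * (a * g t + t * deriv g t)) t := by
    intro t ht
    obtain ⟨h0, h1⟩ := mem_diskSegment_of_mem_uIcc hε hb ht
    have ht0 : (t : ℂ) ≠ 0 := by exact_mod_cast h0.ne'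
    refine ((hasDerivAt_ofReal_cpow_const h0.ne' ha0).mul
      (hg t h1).differentiableAt.hasDerivAt.comp_ofReal).congr_deriv ?_
    rw [Complex.cpow_sub _ _ ht0, Complex.cpow_one]
    field_simp
  rw [fpTo, finitePartZero_euler ha hε.le (hg.mono (closedBall_subset_diskSegment _ _)),
    intervalIntegral.integral_eq_sub_of_hasDerivAt hd hc]
  ring

/-! ### The one-endpoint Cauchy transform: analyticity and decay -/

/-- The finite part of `∫₀^b t ^ (a - 1) * h t / (t - z) dt`. -/
noncomputable def halfTransform (a : ℂ) (h : ℂ → ℂ) (b : ℝ) (z : ℂ) : ℂ :=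
  fpTo a (fun t => h t / (t - z)) (min (‖z‖ / 2) b) b

lemma diskSegment_subset_ball {ε b : ℝ} (hε : ε < 1) (hb : b < 1) :
    diskSegment ε b ⊆ ball 0 1 := by
  rintro _ (h | ⟨t, ht, rfl⟩)
  · exact closedBall_subset_ball hε h
  · simpa [abs_of_nonneg ht.1] using ht.2.trans_lt hb

lemma notMem_diskSegment {ε b : ℝ} {z : ℂ} (hz : z ∉ Complex.ofReal '' Set.Icc 0 b)
    (hε : ε < ‖z‖) : z ∉ diskSegment ε b := by
  rintro (h | h)
  · exact hε.not_ge (by simpa using h)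
  · exact hz h

lemma analyticOnNhd_div_sub_pow {h : ℂ → ℂ} (hh : DifferentiableOn ℂ h (ball 0 1)) {S : Set ℂ}
    (hS : S ⊆ ball 0 1) {z : ℂ} (hz : z ∉ S) (n : ℕ) :
    AnalyticOnNhd ℂ (fun t => h t / (t - z) ^ n) S := fun _ ht =>
  (hh.analyticAt (isOpen_ball.mem_nhds (hS ht))).div
    ((analyticAt_id.sub analyticAt_const).pow n)
    (pow_ne_zero n (sub_ne_zero.2 fun h => hz (h ▸ ht)))

lemma analyticOnNhd_div_sub {h : ℂ → ℂ} (hh : DifferentiableOn ℂ h (ball 0 1)) {S : Set ℂ}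
    (hS : S ⊆ ball 0 1) {z : ℂ} (hz : z ∉ S) :
    AnalyticOnNhd ℂ (fun t => h t / (t - z)) S := by
  simpa using analyticOnNhd_div_sub_pow hh hS hz 1

lemma ne_zero_of_notMem_segment {b : ℝ} (hb : 0 < b) {z : ℂ}
    (hz : z ∉ Complex.ofReal '' Set.Icc 0 b) : z ≠ 0 := by
  rintro rfl
  exact hz ⟨0, ⟨le_rfl, hb.le⟩, rfl⟩

/-- The splitting point in the definition moves with `z`. Here it is replaced by a fixed one, so
that transforms at nearby points can be compared. -/
lemma halfTransform_eq {a : ℂ} (ha : ∀ n : ℕ, (n : ℂ) + a ≠ 0) {h : ℂ → ℂ}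
    (hh : DifferentiableOn ℂ h (ball 0 1)) {b : ℝ} (hb : 0 < b) (hb1 : b < 1) {z : ℂ}
    (hz : z ∉ Complex.ofReal '' Set.Icc 0 b) {ε : ℝ} (hε : 0 < ε) (hε1 : ε < 1) (hεz : ε < ‖z‖) :
    halfTransform a h b z = fpTo a (fun t => h t / (t - z)) ε b := by
  have hz0 : 0 < ‖z‖ := norm_pos_iff.2 (ne_zero_of_notMem_segment hb hz)
  have h1 : min (‖z‖ / 2) b < ‖z‖ := (min_le_left _ _).trans_lt (by linarith)
  exact fpTo_split_eq' ha (lt_min (by linarith) hb) hε hb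
    (analyticOnNhd_div_sub hh (diskSegment_subset_ball ((min_le_right _ _).trans_lt hb1) hb1)
      (notMem_diskSegment hz h1))
    (analyticOnNhd_div_sub hh (diskSegment_subset_ball hε1 hb1) (notMem_diskSegment hz hεz))

lemma hasDerivAt_halfTransform {a : ℂ} (ha : ∀ n : ℕ, (n : ℂ) + a ≠ 0) {h : ℂ → ℂ}
    (hh : DifferentiableOn ℂ h (ball 0 1)) {b : ℝ} (hb : 0 < b) (hb1 : b < 1) {w : ℂ}
    (hw : w ∉ Complex.ofReal '' Set.Icc 0 b) {ε : ℝ} (hε : 0 < ε) (hε1 : ε < 1) (hεw : ε < ‖w‖) :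
    HasDerivAt (halfTransform a h b) (fpTo a (fun t => h t / (t - w) ^ 2) ε b) w := by
  -- The margin between `ε` and `ρ` is what `norm_fpTo_le` consumes.
  obtain ⟨ρ, hερ, hρ⟩ := exists_between (lt_min hε1 hεw)
  obtain ⟨hρ1, hρw⟩ := lt_min_iff.1 hρ
  have hS := diskSegment_subset_ball hρ1 hb1
  have hSε := diskSegment_mono hερ.le le_rfl (b := b) (b' := b)
  have hwS := notMem_diskSegment hw hρw
  obtain ⟨C, hC⟩ := (isCompact_diskSegment ρ b).exists_bound_of_continuousOn
    (hh.continuousOn.mono hS)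
  have hne : (diskSegment ρ b).Nonempty := ⟨0, Or.inl (by simp [(hε.trans hερ).le])⟩
  have hδ := ((isCompact_diskSegment ρ b).isClosed.notMem_iff_infDist_pos hne).1 hwS
  set δ := infDist w (diskSegment ρ b)
  have hδt : ∀ t ∈ diskSegment ρ b, δ ≤ ‖t - w‖ := fun t ht => by
    rw [← dist_eq_norm, dist_comm]; exact infDist_le_dist_of_mem ht
  obtain ⟨K, hK, hbound⟩ := norm_fpTo_le a hε hερ hb
  have hC0 : 0 ≤ C := (norm_nonneg _).trans (hC _ hne.some_mem)
  set d := fpTo a (fun t => h t / (t - w) ^ 2) ε b with hd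
  have hO : (fun z => halfTransform a h b z - halfTransform a h b w - (z - w) * d) =O[𝓝 w]
      fun z => ‖z - w‖ ^ 2 := by
    -- The remainder of the first-order expansion of `1 / (t - z)` at `w` is `(z - w) ^ 2 / ((t - w)
    -- ^ 2 * (t - z))`. With `z` within `δ / 2` of `w`, the denominator is at least `δ ^ 2 * (δ /
    -- 2)` in modulus.
    refine IsBigO.of_bound (K * (C / (δ / 2 * δ ^ 2))) ?_
    filter_upwards [ball_mem_nhds w (half_pos hδ)] with z hz
    rw [mem_ball, dist_eq_norm] at hz
    have hzt : ∀ t ∈ diskSegment ρ b, δ / 2 ≤ ‖t - z‖ := fun t ht => by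
      have h1 := hδt t ht
      have h2 := norm_add_le (t - z) (z - w)
      rw [sub_add_sub_cancel] at h2
      linarith
    have hzS : z ∉ diskSegment ρ b := fun hm => by
      have := hzt z hm
      simp at this
      linarith
    have hzseg : z ∉ Complex.ofReal '' Set.Icc 0 b := fun hm => hzS (Or.inr hm)
    have hzε : ε < ‖z‖ := hερ.trans (not_le.1 fun hm => hzS (Or.inl (by simpa using hm)))
    have h3 := analyticOnNhd_div_sub_pow hh hS hwS 2
    have h1 := analyticOnNhd_div_sub hh hS hzS
    have h2 := analyticOnNhd_div_sub hh hS hwS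
    have h4 : AnalyticOnNhd ℂ (fun t => h t / (t - w) ^ 2 / (t - z)) (diskSegment ρ b) :=
      fun t ht => (h3 t ht).div (analyticAt_id.sub analyticAt_const)
        (sub_ne_zero.2 fun h => hzS (h ▸ ht))
    rw [halfTransform_eq ha hh hb hb1 hzseg hε hε1 hzε, halfTransform_eq ha hh hb hb1 hw hε hε1 hεw,
      hd, ← fpTo_sub a hε hb (h1.mono hSε) (h2.mono hSε), ← fpTo_const_mul, ← fpTo_sub a hε hb
        (f := fun t => h t / (t - z) - h t / (t - w))
        (g := fun t => (z - w) * (h t / (t - w) ^ 2)) ((h1.sub h2).mono hSε) ((analyticOnNhd_const.mul h3).mono hSε),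
      fpTo_congr_set a hε hb (g := fun t => (z - w) ^ 2 * (h t / (t - w) ^ 2 / (t - z))),
      fpTo_const_mul, norm_mul, norm_pow, norm_pow, norm_norm, mul_comm]
    · gcongr
      refine hbound _ _ h4 fun t ht => ?_
      rw [norm_div, norm_div, norm_pow, div_div, mul_comm (‖t - w‖ ^ 2)]
      have := hδt t ht
      have := hzt t ht
      gcongr
      exact hC t ht
    · intro t ht
      have e1 : t - z ≠ 0 := sub_ne_zero.2 fun h => hzS (h ▸ hSε ht)
      have e2 : t - w ≠ 0 := sub_ne_zero.2 fun h => hwS (h ▸ hSε ht)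
      field_simp
      ring
  -- A function that is `O(‖z - w‖ ^ 2)` at `w` has derivative 0 there.
  have h5 := (hO.hasFDerivAt one_lt_two).hasDerivAt
  have h6 := h5.add ((((hasDerivAt_id w).sub_const w).mul_const d).const_add (halfTransform a h b w))
  refine (h6.congr_deriv (by simp)).congr_of_eventuallyEq (Eventually.of_forall fun z => ?_)
  simp only [id, Pi.add_apply]
  ring

lemma isClosed_segment (b : ℝ) : IsClosed (Complex.ofReal '' Set.Icc 0 b) :=
  (isCompact_Icc.image Complex.continuous_ofReal).isClosed

lemma differentiableOn_halfTransform {a : ℂ} (ha : ∀ n : ℕ, (n : ℂ) + a ≠ 0) {h : ℂ → ℂ}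
    (hh : DifferentiableOn ℂ h (ball 0 1)) {b : ℝ} (hb : 0 < b) (hb1 : b < 1) :
    DifferentiableOn ℂ (halfTransform a h b) (Complex.ofReal '' Set.Icc 0 b)ᶜ := by
  intro w hw
  have hw0 : 0 < ‖w‖ := norm_pos_iff.2 (ne_zero_of_notMem_segment hb hw)
  obtain ⟨ε, hε, hε'⟩ := exists_between (lt_min one_pos hw0)
  obtain ⟨h1, h2⟩ := lt_min_iff.1 hε'
  exact (hasDerivAt_halfTransform ha hh hb hb1 hw hε h1
    h2).differentiableAt.differentiableWithinAt

lemma halfTransform_isBigO_inv {a : ℂ} (ha : ∀ n : ℕ, (n : ℂ) + a ≠ 0) {h : ℂ → ℂ}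
    (hh : DifferentiableOn ℂ h (ball 0 1)) {b : ℝ} (hb : 0 < b) (hb1 : b < 1) :
    halfTransform a h b =O[Bornology.cobounded ℂ] (fun z : ℂ => z⁻¹) := by
  obtain ⟨ρ, hbρ, hρ1⟩ := exists_between hb1
  have hS := diskSegment_subset_ball hρ1 hb1
  obtain ⟨C, hC⟩ := (isCompact_diskSegment ρ b).exists_bound_of_continuousOn
    (hh.continuousOn.mono hS)
  obtain ⟨K, hK, hbound⟩ := norm_fpTo_le a hb hbρ hb
  refine IsBigO.of_bound (K * (C * 2)) ?_
  filter_upwards [(hasBasis_cobounded_norm (E := ℂ)).mem_of_mem (i := 2) trivial] with z hz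
  have hz : 2 ≤ ‖z‖ := hz
  have hzt : ∀ t ∈ ball (0 : ℂ) 1, ‖z‖ / 2 ≤ ‖t - z‖ := fun t ht => by
    have h1 := norm_sub_norm_le z t
    rw [norm_sub_rev] at h1
    have h2 : ‖t‖ < 1 := by simpa using ht
    linarith
  have hzS : z ∉ ball (0 : ℂ) 1 := fun hm => by
    have := hzt z hm
    simp at this
    linarith
  have hzseg : z ∉ Complex.ofReal '' Set.Icc 0 b := fun hm =>
    hzS (diskSegment_subset_ball hρ1 hb1 (Or.inr hm))
  rw [halfTransform_eq ha hh hb hb1 hzseg hb hb1 (by linarith), mul_assoc]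
  refine (hbound _ _ (analyticOnNhd_div_sub hh hS fun hm => hzS (hS hm)) fun t ht => ?_)
  have h0 : 0 < ‖z‖ := by linarith
  rw [norm_div]
  calc _ ≤ C / (‖z‖ / 2) := by
        have := hzt t (hS ht)
        have h1 := hC t ht
        have := (norm_nonneg _).trans h1
        gcongr
    _ = _ := by rw [norm_inv]; field_simp

/-! ### The jump across the cut -/

lemma ofReal_sub_ne_zero {z : ℂ} (hz : z.im ≠ 0) (t : ℝ) : (t : ℂ) - z ≠ 0 := fun h => hz (by
  rw [← sub_eq_zero.1 h, Complex.ofReal_im])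

/-- The imaginary part of `t - z` is constant and nonzero, so the principal logarithm is a primitive
along the whole segment. -/
lemma integral_inv_sub {z : ℂ} (hz : z.im ≠ 0) (c d : ℝ) :
    ∫ t in c..d, ((t : ℂ) - z)⁻¹ = Complex.log (d - z) - Complex.log (c - z) := by
  refine intervalIntegral.integral_eq_sub_of_hasDerivAt
    (f := fun t : ℝ => Complex.log ((t : ℂ) - z)) (fun t _ => ?_) ?_
  · have h1 : HasDerivAt (fun w : ℂ => Complex.log (w - z)) ((t : ℂ) - z)⁻¹ t := by
      simpa using ((hasDerivAt_id (t : ℂ)).sub_const z).clog (Or.inr (by simpa using hz))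
    exact h1.comp_ofReal
  · refine ContinuousOn.intervalIntegrable fun t _ => ContinuousAt.continuousWithinAt ?_
    exact (Complex.continuous_ofReal.continuousAt.sub continuousAt_const).inv₀
      (ofReal_sub_ne_zero hz t)

/-- Subtracting the value at `z` itself, rather than at `x`, removes the singularity. For `t` near
`x` the quotient is bounded by a Lipschitz constant of `φ`; elsewhere `‖t - z‖` is bounded below.
Dominated convergence then gives the same limit from both sides. -/
lemma tendsto_integral_difference_quotient {φ : ℂ → ℂ} {c d x : ℝ}
    (hφ : ContinuousOn (fun t : ℝ => φ t) (Set.uIcc c d)) (hx : AnalyticAt ℂ φ x) :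
    Tendsto (fun z : ℂ => ∫ t in c..d, (φ t - φ z) * ((t : ℂ) - z)⁻¹) (𝓝[{z : ℂ | z.im ≠ 0}] (x : ℂ))
      (𝓝 (∫ t in c..d, (φ t - φ x) * ((t : ℂ) - x)⁻¹)) := by
  obtain ⟨K, s, hs, hK⟩ := (hx.contDiffAt (n := 1)).exists_lipschitzOnWith
  obtain ⟨r, hr, hrs⟩ := Metric.mem_nhds_iff.1 hs
  obtain ⟨M, hM⟩ := isCompact_uIcc.exists_bound_of_continuousOn hφ
  have hM0 : 0 ≤ M := (norm_nonneg _).trans (hM c Set.left_mem_uIcc)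
  have hnear : ∀ z ∈ ball (x : ℂ) (r / 2), ‖φ z‖ ≤ ‖φ x‖ + K * r := fun z hz => by
    have hz' : z ∈ ball (x : ℂ) r := ball_subset_ball (by linarith) hz
    have h1 := hK.dist_le_mul z (hrs hz') x (hrs (mem_ball_self hr))
    rw [dist_eq_norm] at h1
    have h2 : (K : ℝ) * dist z x ≤ K * r := by
      have := (mem_ball.1 hz').le
      gcongr
    have h3 := norm_le_norm_add_norm_sub' (φ z) (φ x)
    linarith
  refine intervalIntegral.tendsto_integral_filter_of_dominated_convergence
    (fun _ => K + (M + (‖φ x‖ + K * r)) * (2 / r)) ?_ ?_ (by simp) ?_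
  · filter_upwards [self_mem_nhdsWithin] with z hz
    refine (ContinuousOn.mono ?_ Set.uIoc_subset_uIcc).aestronglyMeasurable measurableSet_uIoc
    exact (hφ.sub continuousOn_const).mul fun t _ =>
      (((Complex.continuous_ofReal.continuousAt.sub continuousAt_const).inv₀
        (ofReal_sub_ne_zero hz t))).continuousWithinAt
  · filter_upwards [mem_nhdsWithin_of_mem_nhds (ball_mem_nhds (x : ℂ) (half_pos hr)),
      self_mem_nhdsWithin] with z hz hz'
    refine Eventually.of_forall fun t ht => ?_
    rw [norm_mul, norm_inv]
    have hpos : 0 < ‖(t : ℂ) - z‖ := norm_pos_iff.2 (ofReal_sub_ne_zero hz' t)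
    by_cases htx : (t : ℂ) ∈ ball (x : ℂ) r
    · have h1 := hK.dist_le_mul t (hrs htx) z (hrs (ball_subset_ball (by linarith) hz))
      rw [dist_eq_norm, dist_eq_norm] at h1
      calc _ ≤ (K : ℝ) * ‖(t : ℂ) - z‖ * ‖(t : ℂ) - z‖⁻¹ := by gcongr
        _ = K := by field_simp
        _ ≤ _ := le_add_of_nonneg_right (by positivity)
    · have h1 : r ≤ ‖(t : ℂ) - x‖ := by simpa [dist_eq_norm] using htx
      have h2 : ‖z - x‖ < r / 2 := by simpa [dist_eq_norm] using hz
      have h3 := norm_add_le ((t : ℂ) - z) (z - x)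
      rw [sub_add_sub_cancel] at h3
      have h4 : r / 2 ≤ ‖(t : ℂ) - z‖ := by linarith
      have h5 : ‖(t : ℂ) - z‖⁻¹ ≤ 2 / r := by
        rw [← inv_div]; exact inv_anti₀ (by positivity) h4
      calc _ ≤ (M + (‖φ x‖ + K * r)) * (2 / r) := by
            refine mul_le_mul ((norm_sub_le _ _).trans ?_) h5 (by positivity) (by positivity)
            exact add_le_add (hM t (Set.uIoc_subset_uIcc ht)) (hnear z hz)
        _ ≤ _ := le_add_of_nonneg_left (by positivity)
  · have hne : ∀ᵐ t : ℝ, t ≠ x := by simp [MeasureTheory.ae_iff]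
    filter_upwards [hne] with t ht _
    have ht' : (t : ℂ) - x ≠ 0 := sub_ne_zero.2 (by exact_mod_cast ht)
    refine Tendsto.mono_left ?_ nhdsWithin_le_nhds
    exact (tendsto_const_nhds.sub hx.continuousAt).mul
      ((tendsto_const_nhds.sub tendsto_id).inv₀ ht')

/-- The Plemelj formula at an interior point near which the density is analytic. -/
lemma exists_jump_integral {φ : ℂ → ℂ} {c d x : ℝ} (hcx : c < x) (hxd : x < d)
    (hφ : ContinuousOn (fun t : ℝ => φ t) (Set.uIcc c d)) (hx : AnalyticAt ℂ φ x) :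
    ∃ P M : ℂ,
      Tendsto (fun z : ℂ => ∫ t in c..d, φ t / ((t : ℂ) - z)) (𝓝[{z : ℂ | 0 < z.im}] (x : ℂ)) (𝓝 P) ∧
      Tendsto (fun z : ℂ => ∫ t in c..d, φ t / ((t : ℂ) - z)) (𝓝[{z : ℂ | z.im < 0}] (x : ℂ)) (𝓝 M) ∧
      P = M + 2 * Real.pi * Complex.I * φ x := by
  have hR := tendsto_integral_difference_quotient hφ hx
  set R := ∫ t in c..d, (φ t - φ x) * ((t : ℂ) - x)⁻¹
  have heq : ∀ z : ℂ, z.im ≠ 0 → ∫ t in c..d, φ t / ((t : ℂ) - z) =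
      (∫ t in c..d, (φ t - φ z) * ((t : ℂ) - z)⁻¹) +
        φ z * (Complex.log (d - z) - Complex.log (c - z)) := fun z hz => by
    have hi : ContinuousOn (fun t : ℝ => ((t : ℂ) - z)⁻¹) (Set.uIcc c d) := fun t _ =>
      ((Complex.continuous_ofReal.continuousAt.sub continuousAt_const).inv₀
        (ofReal_sub_ne_zero hz t)).continuousWithinAt
    have h1 : ContinuousOn (fun t : ℝ => (φ t - φ z) * ((t : ℂ) - z)⁻¹) (Set.uIcc c d) :=
      (hφ.sub continuousOn_const).mul hi
    have h2 : ContinuousOn (fun t : ℝ => φ z * ((t : ℂ) - z)⁻¹) (Set.uIcc c d) :=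
      continuousOn_const.mul hi
    rw [← integral_inv_sub hz, ← intervalIntegral.integral_const_mul,
      ← intervalIntegral.integral_add h1.intervalIntegrable h2.intervalIntegrable]
    refine intervalIntegral.integral_congr fun t _ => ?_
    simp only [div_eq_mul_inv]
    ring
  have hd : ∀ s : Set ℂ, Tendsto (fun z : ℂ => Complex.log (d - z)) (𝓝[s] (x : ℂ))
      (𝓝 (Complex.log (d - x))) := fun s => by
    have h1 : ContinuousAt (fun z : ℂ => Complex.log (d - z)) x :=
      (continuousAt_const.sub continuousAt_id).clog (Or.inl (by simpa using hxd))
    exact h1.tendsto.mono_left nhdsWithin_le_nhds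
  have hsub : Tendsto (fun z : ℂ => (c : ℂ) - z) (𝓝 (x : ℂ)) (𝓝 ((c : ℂ) - x)) :=
    tendsto_const_nhds.sub tendsto_id
  have hre : ((c : ℂ) - x).re < 0 := by simpa using hcx
  have him : ((c : ℂ) - x).im = 0 := by simp
  -- Only `log (c - z)` jumps: `c - x` is negative, and `c - z` approaches it from the side opposite
  -- to that of `z`.
  have hP : Tendsto (fun z : ℂ => Complex.log (c - z)) (𝓝[{z : ℂ | 0 < z.im}] (x : ℂ))
      (𝓝 (Real.log ‖(c : ℂ) - x‖ - Real.pi * Complex.I)) := by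
    refine (Complex.tendsto_log_nhdsWithin_im_neg_of_re_neg_of_im_zero hre him).comp
      (tendsto_nhdsWithin_iff.2 ⟨hsub.mono_left nhdsWithin_le_nhds, ?_⟩)
    filter_upwards [self_mem_nhdsWithin] with z hz
    simpa using hz
  have hM : Tendsto (fun z : ℂ => Complex.log (c - z)) (𝓝[{z : ℂ | z.im < 0}] (x : ℂ))
      (𝓝 (Real.log ‖(c : ℂ) - x‖ + Real.pi * Complex.I)) := by
    refine (Complex.tendsto_log_nhdsWithin_im_nonneg_of_re_neg_of_im_zero hre him).comp
      (tendsto_nhdsWithin_iff.2 ⟨hsub.mono_left nhdsWithin_le_nhds, ?_⟩)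
    filter_upwards [self_mem_nhdsWithin] with z hz
    simpa using (show z.im < 0 from hz).le
  have hφx : ∀ s : Set ℂ, Tendsto φ (𝓝[s] (x : ℂ)) (𝓝 (φ x)) := fun s =>
    hx.continuousAt.tendsto.mono_left nhdsWithin_le_nhds
  refine ⟨_, _, Tendsto.congr' ?_ ((hR.mono_left (nhdsWithin_mono _ ?_)).add
      ((hφx _).mul ((hd _).sub hP))),
    Tendsto.congr' ?_ ((hR.mono_left (nhdsWithin_mono _ ?_)).add
      ((hφx _).mul ((hd _).sub hM))), by ring⟩
  · filter_upwards [self_mem_nhdsWithin] with z hz using (heq z (ne_of_gt hz)).symm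
  · exact fun z hz => ne_of_gt hz
  · filter_upwards [self_mem_nhdsWithin] with z hz using (heq z (ne_of_lt hz)).symm
  · exact fun z hz => ne_of_lt hz

lemma notMem_segment_of_im_ne_zero {z : ℂ} (hz : z.im ≠ 0) (s : Set ℝ) :
    z ∉ Complex.ofReal '' s := by
  rintro ⟨t, _, rfl⟩
  exact hz (Complex.ofReal_im t)

/-- Cut the segment at `x / 2`. The part from 0 to `x / 2` carries the finite part but is analytic
near `x`; the rest is an ordinary integral, to which Plemelj's formula applies. -/
lemma exists_jump_halfTransform {a : ℂ} (ha : ∀ n : ℕ, (n : ℂ) + a ≠ 0) {h : ℂ → ℂ}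
    (hh : DifferentiableOn ℂ h (ball 0 1)) {b : ℝ} (hb1 : b < 1) {x : ℝ} (hx : 0 < x)
    (hxb : x < b) :
    ∃ P M : ℂ,
      Tendsto (halfTransform a h b) (𝓝[{z : ℂ | 0 < z.im}] (x : ℂ)) (𝓝 P) ∧
      Tendsto (halfTransform a h b) (𝓝[{z : ℂ | z.im < 0}] (x : ℂ)) (𝓝 M) ∧
      P = M + 2 * Real.pi * Complex.I * ((x : ℂ) ^ (a - 1) * h x) := by
  have hε : 0 < x / 2 := by positivity
  have hb : 0 < b := hx.trans hxb
  have hball : ∀ t ∈ Set.uIcc (x / 2) b, (t : ℂ) ∈ ball (0 : ℂ) 1 ∧ 0 < t := fun t ht => by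
    rw [Set.uIcc_of_le (by linarith)] at ht
    have h0 : 0 < t := hε.trans_le ht.1
    exact ⟨by simpa [abs_of_pos h0] using ht.2.trans_lt hb1, h0⟩
  have hxI : x ∈ Set.uIcc (x / 2) b := by
    rw [Set.uIcc_of_le (by linarith)]; constructor <;> linarith
  obtain ⟨P, M, hP, hM, hPM⟩ := exists_jump_integral (φ := fun t => t ^ (a - 1) * h t)
    (c := x / 2) (d := b) (x := x) (by linarith) hxb
    ((continuousOn_cpow_uIcc (a - 1) hε hb).mul
      (hh.continuousOn.comp Complex.continuous_ofReal.continuousOn fun t ht => (hball t ht).1))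
    ((analyticAt_id.cpow analyticAt_const (Or.inl (by simpa using hx))).mul
      (hh.analyticAt (isOpen_ball.mem_nhds (hball x hxI).1)))
  have hε1 : x / 2 < 1 := by linarith
  have hxε : (x : ℂ) ∉ Complex.ofReal '' Set.Icc 0 (x / 2) := by
    rintro ⟨t, ht, hte⟩
    have : t = x := by exact_mod_cast hte
    linarith [ht.2]
  have hc : ∀ s : Set ℂ, Tendsto (halfTransform a h (x / 2)) (𝓝[s] (x : ℂ))
      (𝓝 (halfTransform a h (x / 2) x)) := fun s =>
    ((differentiableOn_halfTransform ha hh hε hε1).differentiableAt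
      ((isClosed_segment _).isOpen_compl.mem_nhds hxε)).continuousAt.tendsto.mono_left
      nhdsWithin_le_nhds
  have hlarge : ∀ᶠ z : ℂ in 𝓝 (x : ℂ), x / 2 < ‖z‖ :=
    continuous_norm.continuousAt.eventually_const_lt
      (by simp only [Complex.norm_real, Real.norm_of_nonneg hx.le]; linarith)
  have heq : ∀ z : ℂ, z.im ≠ 0 → x / 2 < ‖z‖ → halfTransform a h (x / 2) z +
      (∫ t in (x / 2)..b, (t : ℂ) ^ (a - 1) * h t / ((t : ℂ) - z)) = halfTransform a h b z := by
    intro z hz hz'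
    rw [halfTransform_eq ha hh hε hε1 (notMem_segment_of_im_ne_zero hz _) hε hε1 hz', fpTo_self,
      halfTransform_eq ha hh hb hb1 (notMem_segment_of_im_ne_zero hz _) hε hε1 hz', fpTo]
    simp only [mul_div_assoc]
  refine ⟨_, _, ((hc _).add hP).congr' ?_, ((hc _).add hM).congr' ?_, by rw [hPM]; ring⟩
  · filter_upwards [self_mem_nhdsWithin, mem_nhdsWithin_of_mem_nhds hlarge] with z hz hz' using
      heq z (ne_of_gt hz) hz'
  · filter_upwards [self_mem_nhdsWithin, mem_nhdsWithin_of_mem_nhds hlarge] with z hz hz' using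
      heq z (ne_of_lt hz) hz'

/-! ### Behaviour at an endpoint: a differential equation in `z` -/

/-- The open disk of radius `r` around `0`, slit along `[0, r)`. -/
def slitDisk (r : ℝ) : Set ℂ := ball 0 r ∩ {z | -z ∈ Complex.slitPlane}

lemma isOpen_slitDisk (r : ℝ) : IsOpen (slitDisk r) :=
  isOpen_ball.inter (Complex.isOpen_slitPlane.preimage continuous_neg)

lemma isPreconnected_slitDisk {r : ℝ} (hr : 0 < r) : IsPreconnected (slitDisk r) := by
  have hc : StarConvex ℝ (-(r / 2 : ℝ) : ℂ) (slitDisk r) := by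
    refine StarConvex.inter ((convex_ball (0 : ℂ) r).starConvex ?_) ?_
    · simp only [mem_ball_zero_iff, norm_neg, Complex.norm_real, Real.norm_eq_abs]
      rw [abs_of_pos (by positivity)]
      linarith
    · intro z hz s t hs ht hst
      simp only [Set.mem_ofPred_eq, Complex.mem_slitPlane_iff] at hz ⊢
      simp only [Complex.neg_re, Complex.neg_im, Complex.add_re, Complex.add_im, Complex.smul_re,
        Complex.smul_im, Complex.ofReal_re, Complex.ofReal_im, smul_eq_mul, neg_zero, mul_zero,
        zero_add] at hz ⊢
      rcases ht.eq_or_lt with rfl | ht'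
      · left
        have : s = 1 := by linarith
        subst this
        linarith
      · rcases hz with hz | hz
        · left
          have := mul_pos ht' hz
          have := mul_nonneg hs (by positivity : (0 : ℝ) ≤ r / 2)
          linarith
        · right
          exact neg_ne_zero.2 (mul_ne_zero ht'.ne' (neg_ne_zero.1 hz))
  have hmem : (-(r / 2 : ℝ) : ℂ) ∈ slitDisk r :=
    ⟨by simp [abs_of_pos hr, hr], Or.inl (by simpa using hr)⟩
  exact (hc.isPathConnected hmem).isConnected.isPreconnected

lemma ne_zero_of_mem_slitDisk {r : ℝ} {z : ℂ} (hz : z ∈ slitDisk r) : z ≠ 0 := by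
  rintro rfl
  simpa using hz.2

lemma mem_slitDisk {r b : ℝ} (hrb : r ≤ b) {z : ℂ} (hz : z ∈ ball (0 : ℂ) r) :
    z ∈ slitDisk r ↔ z ∉ Complex.ofReal '' Set.Icc 0 b := by
  constructor
  · rintro ⟨_, h⟩ ⟨t, ht, rfl⟩
    rw [Set.mem_ofPred_eq, Complex.mem_slitPlane_iff] at h
    simp only [Complex.neg_re, Complex.ofReal_re, Complex.neg_im, Complex.ofReal_im] at h
    rcases h with h | h
    · linarith [ht.1]
    · simp at h
  · intro h
    refine ⟨hz, ?_⟩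
    by_contra hn
    rw [Set.mem_ofPred_eq, Complex.mem_slitPlane_iff] at hn
    push Not at hn
    simp only [Complex.neg_re, Complex.neg_im, neg_eq_zero, Left.neg_nonpos_iff] at hn
    refine h ⟨z.re, ⟨hn.1, ?_⟩, Complex.ext rfl (by simp [hn.2])⟩
    have h1 := Complex.re_le_norm z
    have h2 : ‖z‖ < r := by simpa using hz
    linarith

lemma hasDerivAt_log_neg {z : ℂ} (hz : -z ∈ Complex.slitPlane) :
    HasDerivAt (fun w : ℂ => Complex.log (-w)) z⁻¹ z := by
  convert! (hasDerivAt_neg z).clog hz using 1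
  simp [div_eq_mul_inv, inv_neg]

lemma hasDerivAt_cutPow (a : ℂ) {z : ℂ} (hz : -z ∈ Complex.slitPlane) :
    HasDerivAt (cutPow a) (a * z⁻¹ * cutPow a z) z := by
  have h1 := (((hasDerivAt_log_neg hz).add_const ((Real.pi : ℂ) * Complex.I)).const_mul a).cexp
  exact h1.congr_deriv (by rw [cutPow]; ring)

lemma cutPow_neg_mul_cutPow (a z : ℂ) : cutPow (-a) z * cutPow a z = 1 := by
  rw [cutPow, cutPow, ← Complex.exp_add]
  ring_nf
  exact Complex.exp_zero

lemma cutPow_natCast (m : ℕ) {z : ℂ} (hz : z ≠ 0) : cutPow m z = z ^ m := by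
  rw [cutPow, Complex.exp_nat_mul, Complex.exp_add, Complex.exp_log (neg_ne_zero.2 hz),
    Complex.exp_pi_mul_I]
  ring

/-- `E` times `cutPow (-a)` has zero derivative on the connected slit disk. -/
lemma exists_eq_mul_cutPow {E : ℂ → ℂ} {a : ℂ} {r : ℝ} (hr : 0 < r)
    (hE : ∀ z ∈ slitDisk r, ∃ d, HasDerivAt E d z ∧ z * d = a * E z) :
    ∃ c, ∀ z ∈ slitDisk r, E z = c * cutPow a z := by
  have hD : ∀ z ∈ slitDisk r, HasDerivAt (fun z => E z * cutPow (-a) z) 0 z := fun z hz => by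
    obtain ⟨d, hd, he⟩ := hE z hz
    refine (hd.mul (hasDerivAt_cutPow (-a) hz.2)).congr_deriv ?_
    have hz0 := ne_zero_of_mem_slitDisk hz
    have : d = a * E z * z⁻¹ := by rw [← he]; field_simp
    rw [this]
    ring
  by_cases hne : (slitDisk r).Nonempty
  · obtain ⟨w, hw⟩ := hne
    refine ⟨E w * cutPow (-a) w, fun z hz => ?_⟩
    have h1 := (isOpen_slitDisk r).is_const_of_deriv_eq_zero (isPreconnected_slitDisk hr)
      (fun y hy => (hD y hy).differentiableAt.differentiableWithinAt)
      (fun y hy => (hD y hy).deriv) hz hw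
    rw [← h1, mul_assoc, cutPow_neg_mul_cutPow, mul_one]
  · exact ⟨0, fun z hz => (hne ⟨z, hz⟩).elim⟩

/-- Integration by parts for `1 / (t - z)`: since `t = (t - z) + z`, the integrand `a / (t - z) - t
/ (t - z) ^ 2` equals `(a - 1) / (t - z) - z / (t - z) ^ 2`, so the finite part of the latter is the
boundary term at `b`. -/
lemma hasDerivAt_halfTransform_one {a : ℂ} (ha : ∀ n : ℕ, (n : ℂ) + a ≠ 0) {b : ℝ} (hb : 0 < b)
    (hb1 : b < 1) {z : ℂ} (hz : z ∉ Complex.ofReal '' Set.Icc 0 b) :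
    ∃ d, HasDerivAt (halfTransform a (fun _ => 1) b) d z ∧
      z * d - (a - 1) * halfTransform a (fun _ => 1) b z = -((b : ℂ) ^ a / (b - z)) := by
  have hz0 : 0 < ‖z‖ := norm_pos_iff.2 (ne_zero_of_notMem_segment hb hz)
  have hh : DifferentiableOn ℂ (fun _ : ℂ => (1 : ℂ)) (ball 0 1) := differentiableOn_const _
  obtain ⟨ε, hε, hε'⟩ := exists_between (lt_min one_pos hz0)
  obtain ⟨hε1, hεz⟩ := lt_min_iff.1 hε'
  have hS := diskSegment_subset_ball hε1 hb1
  have hzS := notMem_diskSegment hz hεz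
  refine ⟨_, hasDerivAt_halfTransform ha hh hb hb1 hz hε hε1 hεz, ?_⟩
  have h1 := analyticOnNhd_div_sub hh hS hzS
  have h2 := analyticOnNhd_div_sub_pow hh hS hzS 2
  have h3 := fpTo_euler ha hε hb h1
  rw [halfTransform_eq ha hh hb hb1 hz hε hε1 hεz, ← fpTo_const_mul, ← fpTo_const_mul,
    ← fpTo_sub a hε hb (f := fun t => z * (1 / (t - z) ^ 2)) (g := fun t => (a - 1) * (1 / (t - z)))
      (analyticOnNhd_const.mul h2) (analyticOnNhd_const.mul h1),
    div_eq_mul_one_div ((b : ℂ) ^ a), ← h3, neg_eq_neg_one_mul, ← fpTo_const_mul]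
  refine fpTo_congr_set a hε hb fun t ht => ?_
  have htz : t - z ≠ 0 := sub_ne_zero.2 fun h => hzS (h ▸ ht)
  have h4 : HasDerivAt (fun t => 1 / (t - z)) (-1 / (t - z) ^ 2) t := by
    simpa using! ((hasDerivAt_id t).sub_const z).inv htz
  rw [h4.deriv]
  field_simp
  ring

lemma exists_halfTransform_one_eq_add {a : ℂ} (ha : ∀ n : ℕ, (n : ℂ) + a ≠ 0) {b : ℝ} (hb : 0 < b)
    (hb1 : b < 1) {r : ℝ} (hr : 0 < r) (hrb : r ≤ b) {T : ℂ → ℂ}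
    (hT : ∀ z ∈ slitDisk r, ∃ d, HasDerivAt T d z ∧
      z * d - (a - 1) * T z = -((b : ℂ) ^ a / (b - z))) :
    ∃ c, ∀ z ∈ slitDisk r, halfTransform a (fun _ => 1) b z = c * cutPow (a - 1) z + T z := by
  obtain ⟨c, hc⟩ := exists_eq_mul_cutPow (a := a - 1)
    (E := fun z => halfTransform a (fun _ => 1) b z - T z) hr fun z hz => by
      obtain ⟨d, hd, he⟩ := hasDerivAt_halfTransform_one ha hb hb1 ((mem_slitDisk hrb hz.1).1 hz)
      obtain ⟨d', hd', he'⟩ := hT z hz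
      exact ⟨d - d', hd.sub hd', by linear_combination he - he'⟩
  exact ⟨c, fun z hz => by linear_combination hc z hz⟩

lemma analyticOnNhd_geometric {r b : ℝ} (hrb : r < b) :
    AnalyticOnNhd ℂ (fun z : ℂ => (b : ℂ) / (b - z)) (closedBall 0 r) := fun z hz =>
  analyticAt_const.div (analyticAt_const.sub analyticAt_id) (sub_ne_zero.2 fun h => by
    have h1 : ‖z‖ ≤ r := by simpa using hz
    rw [← h, Complex.norm_real] at h1
    linarith [Real.le_norm_self b])

lemma cpow_mul_geometric (a : ℂ) {b : ℝ} (hb : 0 < b) (z : ℂ) :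
    (b : ℂ) ^ (a - 1) * (b / (b - z)) = (b : ℂ) ^ a / (b - z) := by
  have hb' : (b : ℂ) ≠ 0 := by exact_mod_cast hb.ne'
  rw [Complex.cpow_sub _ _ hb', Complex.cpow_one]
  field_simp

/-- Non-resonant case: the Euler equation with exponent `-(a - 1)` has a power series solution,
which after scaling by `-b ^ (a - 1)` is the particular solution `T`. -/
lemma halfTransform_one_eq {a : ℂ} (ha : ∀ n : ℕ, (n : ℂ) + a ≠ 0) (ha' : ∀ n : ℕ, a - 1 ≠ n)
    {b : ℝ} (hb : 0 < b) (hb1 : b < 1) :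
    ∃ (c : ℂ) (u : ℂ → ℂ), ContinuousAt u 0 ∧ ∀ z ∈ slitDisk (b / 2),
      halfTransform a (fun _ => 1) b z = c * cutPow (a - 1) z + u z := by
  have hg := analyticOnNhd_geometric (half_lt_self hb)
  have hu := fun z (hz : ‖z‖ < b / 2) => hasDerivAt_eulerSolution (a := -(a - 1)) hg
    (fun n hn => absurd (by linear_combination -hn) (ha' n)) hz
  set u := eulerSolution (-(a - 1)) (fun z : ℂ => (b : ℂ) / (b - z))
  obtain ⟨c, hc⟩ := exists_halfTransform_one_eq_add ha hb hb1 (half_pos hb) (half_le_self hb.le)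
    (T := fun z => -(b : ℂ) ^ (a - 1) * u z) fun z hz => by
      obtain ⟨d, hd, he⟩ := hu z (by simpa using hz.1)
      refine ⟨_, hd.const_mul _, ?_⟩
      rw [← cpow_mul_geometric a hb, ← he]
      ring
  obtain ⟨d, hd, -⟩ := hu 0 (by simpa using hb)
  exact ⟨c, _, continuousAt_const.mul hd.continuousAt, hc⟩

lemma taylorCoeffZero_pow (m : ℕ) : taylorCoeffZero (fun z => z ^ m) m = 1 := by
  have : (m.factorial : ℂ) ≠ 0 := by exact_mod_cast m.factorial_ne_zero
  simp [taylorCoeffZero, Nat.descFactorial_self, this]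

/-- Resonant case: the coefficient of `z ^ m` on the right obstructs a power series solution. It is
subtracted off and recovered from `z ^ m * log (-z)`, which `z d/dz - m` maps to `z ^ m`. -/
lemma halfTransform_one_eq_of_nat (m : ℕ) {b : ℝ} (hb : 0 < b) (hb1 : b < 1) :
    ∃ (c κ : ℂ) (u : ℂ → ℂ), ContinuousAt u 0 ∧ ∀ z ∈ slitDisk (b / 2),
      halfTransform (m + 1) (fun _ => 1) b z =
        c * z ^ m + (u z + κ * (z ^ m * Complex.log (-z))) := by
  have ha : ∀ n : ℕ, (n : ℂ) + (m + 1) ≠ 0 := fun n => by exact_mod_cast (n + m).succ_ne_zero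
  have hg := analyticOnNhd_geometric (half_lt_self hb)
  set κ := taylorCoeffZero (fun z : ℂ => (b : ℂ) / (b - z)) m with hκ
  have hp : AnalyticOnNhd ℂ (fun z : ℂ => -κ * z ^ m) (closedBall 0 (b / 2)) := fun z _ =>
    analyticAt_const.mul (analyticAt_id.pow m)
  have h0 : (0 : ℂ) ∈ closedBall (0 : ℂ) (b / 2) := by simp; positivity
  have hu := fun z (hz : ‖z‖ < b / 2) => hasDerivAt_eulerSolution (a := -(m : ℂ))
    (g := fun z : ℂ => (b : ℂ) / (b - z) + -κ * z ^ m) (hg.add hp)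
    (fun n hn => by
      have hnm : n = m := by exact_mod_cast (by linear_combination hn : (n : ℂ) = m)
      rw [hnm, taylorCoeffZero_add (hg 0 h0) (hp 0 h0), taylorCoeffZero_const_mul,
        taylorCoeffZero_pow, ← hκ]
      ring) hz
  set u := eulerSolution (-(m : ℂ)) (fun z : ℂ => (b : ℂ) / (b - z) + -κ * z ^ m)
  obtain ⟨c, hc⟩ := exists_halfTransform_one_eq_add ha hb hb1 (half_pos hb) (half_le_self hb.le)
    (T := fun z => -(b : ℂ) ^ (m : ℂ) * u z + -(b : ℂ) ^ (m : ℂ) * κ * (z ^ m * Complex.log (-z)))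
    fun z hz => by
      obtain ⟨d, hd, he⟩ := hu z (by simpa using hz.1)
      have hz0 := ne_zero_of_mem_slitDisk hz
      refine ⟨_, (hd.const_mul _).add
        (((hasDerivAt_pow m z).mul (hasDerivAt_log_neg hz.2)).const_mul _), ?_⟩
      have hpow : z * ((m : ℂ) * z ^ (m - 1)) = m * z ^ m := by
        rcases m with _ | m
        · simp
        · rw [Nat.add_sub_cancel]; ring
      have hinv : z * (z ^ m * z⁻¹) = z ^ m := by field_simp
      have hgeo := cpow_mul_geometric (m + 1) hb z
      rw [add_sub_cancel_right] at hgeo ⊢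
      rw [← hgeo]
      linear_combination (-(b : ℂ) ^ (m : ℂ)) * he +
        (-(b : ℂ) ^ (m : ℂ) * κ * Complex.log (-z)) * hpow + (-(b : ℂ) ^ (m : ℂ) * κ) * hinv
  obtain ⟨d, hd, -⟩ := hu 0 (by simpa using hb)
  refine ⟨c, -(b : ℂ) ^ (m : ℂ) * κ, fun z => -(b : ℂ) ^ (m : ℂ) * u z, continuousAt_const.mul hd.continuousAt,
    fun z hz => ?_⟩
  rw [hc z hz, add_sub_cancel_right, cutPow_natCast m (ne_zero_of_mem_slitDisk hz)]

/-- The integrand of the difference is the difference quotient `(h t - h z) / (t - z)`, analytic in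
`t` even at `t = z`. The splitting point may then pass `z` and move to `b`, and the quotient is
bounded by the supremum of the derivative of `h`, uniformly in `z`. -/
lemma exists_norm_halfTransform_sub_le {a : ℂ} (ha : ∀ n : ℕ, (n : ℂ) + a ≠ 0) {h : ℂ → ℂ}
    (hh : DifferentiableOn ℂ h (ball 0 1)) {b : ℝ} (hb : 0 < b) (hb1 : b < 1) :
    ∃ C, ∀ z ∈ slitDisk b,
      ‖halfTransform a h b z - h z * halfTransform a (fun _ => 1) b z‖ ≤ C := by
  obtain ⟨ρ, hbρ, hρ1⟩ := exists_between hb1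
  have hball : closedBall (0 : ℂ) ρ ⊆ ball 0 1 := closedBall_subset_ball hρ1
  obtain ⟨L, hL⟩ := (isCompact_closedBall (0 : ℂ) ρ).exists_bound_of_continuousOn
    ((hh.deriv isOpen_ball).continuousOn.mono hball)
  obtain ⟨K, hK, hbound⟩ := norm_fpTo_le a hb hbρ hb
  refine ⟨K * L, fun z hz => ?_⟩
  have hzb : ‖z‖ < b := by simpa using hz.1
  have hzseg := (mem_slitDisk le_rfl hz.1).1 hz
  have hz0 : 0 < ‖z‖ := norm_pos_iff.2 (ne_zero_of_mem_slitDisk hz)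
  have hz1 : z ∈ ball (0 : ℂ) 1 := by simpa using hzb.trans hb1
  obtain ⟨ε, hε, hεz⟩ := exists_between hz0
  have hε1 : ε < 1 := hεz.trans (hzb.trans hb1)
  have hk : AnalyticOnNhd ℂ (dslope h z) (ball 0 1) :=
    ((Complex.differentiableOn_dslope (isOpen_ball.mem_nhds hz1)).2 hh).analyticOnNhd isOpen_ball
  have hone : DifferentiableOn ℂ (fun _ : ℂ => (1 : ℂ)) (ball 0 1) := differentiableOn_const _
  have hS := diskSegment_subset_ball hε1 hb1
  have hzS := notMem_diskSegment hzseg hεz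
  have h1 := analyticOnNhd_div_sub hh hS hzS
  have h2 := analyticOnNhd_div_sub hone hS hzS
  have key : halfTransform a h b z - h z * halfTransform a (fun _ => 1) b z =
      fpTo a (dslope h z) b b := by
    rw [halfTransform_eq ha hh hb hb1 hzseg hε hε1 hεz,
      halfTransform_eq ha hone hb hb1 hzseg hε hε1 hεz, ← fpTo_const_mul,
      ← fpTo_sub a hε hb h1 (g := fun t => h z * (1 / (t - z))) (analyticOnNhd_const.mul h2),
      ← fpTo_split_eq ha hε (hεz.trans hzb).le hb (hk.mono (diskSegment_subset_ball hb1 hb1))]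
    refine fpTo_congr_set a hε hb fun t ht => ?_
    rw [dslope_of_ne _ (by rintro rfl; exact hzS ht), slope_def_field]
    ring
  rw [key]
  refine hbound _ _ (hk.mono (diskSegment_subset_ball hρ1 hb1)) fun t ht => ?_
  have htρ : t ∈ closedBall (0 : ℂ) ρ := by
    rcases ht with ht | ⟨s, hs, rfl⟩
    · exact ht
    · simpa [abs_of_nonneg hs.1] using hs.2.trans hbρ.le
  have hzρ : z ∈ closedBall (0 : ℂ) ρ := by simpa using (hzb.trans hbρ).le
  by_cases htz : t = z
  · rw [htz, dslope_same]; exact hL z hzρ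
  · rw [dslope_of_ne _ htz, slope_def_field, norm_div]
    rw [div_le_iff₀ (norm_pos_iff.2 (sub_ne_zero.2 htz))]
    exact (convex_closedBall (0 : ℂ) ρ).norm_image_sub_le_of_norm_deriv_le
      (fun y hy => hh.differentiableAt (isOpen_ball.mem_nhds (hball hy))) hL hzρ htρ

/-! ### The endpoint condition for the one-endpoint transform -/

lemma zero_mem_unitCut : (0 : ℂ) ∈ unitCut := ⟨0, by simp, by simp⟩

lemma one_mem_unitCut : (1 : ℂ) ∈ unitCut := ⟨1, by simp, by simp⟩

lemma one_sub_mem_unitCut {z : ℂ} : 1 - z ∈ unitCut ↔ z ∈ unitCut := by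
  have key : ∀ w ∈ unitCut, 1 - w ∈ unitCut := by
    rintro _ ⟨t, ht, rfl⟩
    exact ⟨1 - t, ⟨by linarith [ht.2], by linarith [ht.1]⟩, by push_cast; ring⟩
  exact ⟨fun h => by simpa using key _ h, key z⟩

lemma segment_subset_unitCut {b : ℝ} (hb : b ≤ 1) : Complex.ofReal '' Set.Icc 0 b ⊆ unitCut :=
  Set.image_mono (Set.Icc_subset_Icc_right hb)

lemma isClosed_unitCut : IsClosed unitCut := isClosed_segment 1

lemma eventually_mem_slitDisk {r : ℝ} (hr : 0 < r) (hr1 : r ≤ 1) :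
    ∀ᶠ z in 𝓝[unitCutᶜ] (0 : ℂ), z ∈ slitDisk r := by
  filter_upwards [self_mem_nhdsWithin, mem_nhdsWithin_of_mem_nhds (ball_mem_nhds (0 : ℂ) hr)]
    with z hz hz' using (mem_slitDisk hr1 hz').2 hz

lemma norm_mul_log_neg_le {z : ℂ} (hz0 : z ≠ 0) (hz : ‖z‖ ≤ 1) :
    ‖z * Complex.log (-z)‖ ≤ 1 + Real.pi := by
  have h0 : 0 < ‖z‖ := norm_pos_iff.2 hz0
  have h1 := (Real.abs_log_mul_self_lt _ h0 hz).le
  rw [abs_mul, abs_of_pos h0] at h1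
  have h2 : ‖Complex.log (-z)‖ ≤ |Real.log ‖z‖| + Real.pi := by
    refine (Complex.norm_le_abs_re_add_abs_im _).trans ?_
    rw [Complex.log_re, Complex.log_im, norm_neg]
    gcongr
    exact Complex.abs_arg_le_pi _
  rw [norm_mul]
  calc _ ≤ ‖z‖ * (|Real.log ‖z‖| + Real.pi) := by gcongr
    _ = |Real.log ‖z‖| * ‖z‖ + ‖z‖ * Real.pi := by ring
    _ ≤ 1 + 1 * Real.pi := by gcongr
    _ = _ := by ring

lemma isBigO_one_of_continuousAt {u : ℂ → ℂ} {w : ℂ} (hu : ContinuousAt u w) (s : Set ℂ) :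
    u =O[𝓝[s] w] (fun _ => (1 : ℝ)) :=
  (hu.tendsto.mono_left nhdsWithin_le_nhds).isBigO_one ℝ

lemma exists_halfTransform_sub_isBigO {α : ℂ} (hα : ∀ n : ℕ, (n : ℂ) + (α + 1) ≠ 0) {h : ℂ → ℂ}
    (hh : DifferentiableOn ℂ h (ball 0 1)) (h0 : α = 0 → h 0 = 0) {b : ℝ} (hb : 0 < b)
    (hb1 : b < 1) : ∃ f₀ : ℂ → ℂ, AnalyticAt ℂ f₀ 0 ∧
      (fun z => halfTransform (α + 1) h b z - cutPow α z * f₀ z) =O[𝓝[unitCutᶜ] (0 : ℂ)]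
        (fun _ => (1 : ℝ)) := by
  have hha : AnalyticAt ℂ h 0 := hh.analyticAt (ball_mem_nhds _ one_pos)
  have hev := eventually_mem_slitDisk (half_pos hb) (by linarith)
  have hev' := eventually_mem_slitDisk hb hb1.le
  obtain ⟨C, hC⟩ := exists_norm_halfTransform_sub_le hα hh hb hb1
  have hCO : (fun z => halfTransform (α + 1) h b z - h z * halfTransform (α + 1) (fun _ => 1) b z)
      =O[𝓝[unitCutᶜ] (0 : ℂ)] (fun _ => (1 : ℝ)) := by
    refine IsBigO.of_bound C ?_
    filter_upwards [hev'] with z hz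
    simpa using hC z hz
  have hhO := isBigO_one_of_continuousAt hha.continuousAt unitCutᶜ
  by_cases hnat : ∃ m : ℕ, α = m
  · obtain ⟨m, rfl⟩ := hnat
    -- For natural `α` the power term is itself bounded, so no germ is needed.
    refine ⟨fun _ => 0, analyticAt_const, ?_⟩
    obtain ⟨c, κ, u, hu, hJ⟩ := halfTransform_one_eq_of_nat m hb hb1
    -- The factor `z` that tames the logarithm comes from `h 0 = 0` when `m = 0`, and from `z ^ m`
    -- otherwise.
    have hzO : (fun z => h z * z ^ m) =O[𝓝[unitCutᶜ] (0 : ℂ)] (fun z : ℂ => z) := by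
      rcases m with _ | m
      · have := hha.differentiableAt.isBigO_sub.mono (nhdsWithin_le_nhds (s := unitCutᶜ))
        simpa [h0 (by simp)] using this
      · have h1 : (fun z : ℂ => h z * z ^ m) =O[𝓝[unitCutᶜ] (0 : ℂ)] (fun _ => (1 : ℂ)) :=
          ((hha.continuousAt.mul (by fun_prop : ContinuousAt (fun z : ℂ => z ^ m)
            0)).tendsto.mono_left nhdsWithin_le_nhds).isBigO_one ℂ
        have h2 := h1.mul (isBigO_refl (fun z : ℂ => z) (𝓝[unitCutᶜ] (0 : ℂ)))
        simpa [pow_succ, mul_assoc] using h2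
    have hlog : (fun z : ℂ => h z * z ^ m * Complex.log (-z)) =O[𝓝[unitCutᶜ] (0 : ℂ)]
        (fun _ => (1 : ℝ)) := by
      refine (hzO.mul (isBigO_refl (fun z : ℂ => Complex.log (-z)) _)).trans ?_
      refine IsBigO.of_bound (1 + Real.pi) ?_
      filter_upwards [hev'] with z hz
      have hzb : ‖z‖ < b := by simpa using hz.1
      simpa using norm_mul_log_neg_le (ne_zero_of_mem_slitDisk hz) (hzb.trans hb1).le
    have h3 := isBigO_one_of_continuousAt
      ((hha.continuousAt.mul ((continuousAt_const (y := c)).mul (continuousAt_id.pow m))).add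
        (hha.continuousAt.mul hu)) unitCutᶜ
    refine ((hCO.add h3).add (hlog.const_mul_left κ)).congr' ?_ EventuallyEq.rfl
    filter_upwards [hev] with z hz
    simp only [Pi.add_apply, Pi.mul_apply, Pi.pow_apply, id]
    rw [hJ z hz]
    ring
  · push Not at hnat
    obtain ⟨c, u, hu, hJ⟩ := halfTransform_one_eq hα (by simpa using hnat) hb hb1
    refine ⟨fun z => c * h z, analyticAt_const.mul hha, ?_⟩
    refine (hCO.add (isBigO_one_of_continuousAt (hha.continuousAt.mul hu) unitCutᶜ)).congr' ?_
      EventuallyEq.rfl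
    filter_upwards [hev] with z hz
    simp only [Pi.mul_apply]
    rw [hJ z hz, add_sub_cancel_right]
    ring

/-! ### Independence of the splitting points -/

lemma differentiableOn_one_sub_cpow (β : ℂ) :
    DifferentiableOn ℂ (fun t : ℂ => (1 - t) ^ β) (ball 0 1) := fun t ht => by
  have h1 : (1 - t) ∈ Complex.slitPlane := Or.inl (by
    have h2 := Complex.re_le_norm t
    have h3 : ‖t‖ < 1 := by simpa using ht
    simp only [Complex.sub_re, Complex.one_re]
    linarith)
  exact ((differentiableAt_const 1).sub differentiableAt_id).cpow
    (differentiableAt_const β) h1 |>.differentiableWithinAt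

lemma analyticAt_one_sub {g : ℂ → ℂ} {s : ℂ} (hg : AnalyticAt ℂ g (1 - s)) :
    AnalyticAt ℂ (fun s => g (1 - s)) s :=
  AnalyticAt.fun_comp (f := fun s : ℂ => 1 - s) hg (analyticAt_const.sub analyticAt_id)

/-- The reflection `t ↦ 1 - t` exchanges the two endpoints of a splitting. -/
lemma IsSplitting.analyticOnNhd_reflect {g : ℂ → ℂ} {ξ₀ ξ₁ : ℝ} (hg : AnalyticOnNhd ℂ g unitCut)
    (hs : IsSplitting g ξ₀ ξ₁) (α : ℂ) {b : ℝ} (hb1 : b < 1) :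
    AnalyticOnNhd ℂ (fun s => (1 - s) ^ α * g (1 - s)) (diskSegment (1 - ξ₁) b) := by
  have h1 := hs.pos
  have h2 := hs.le
  intro s hm
  refine ((differentiableOn_one_sub_cpow α).analyticAt
    (isOpen_ball.mem_nhds (diskSegment_subset_ball (by linarith) hb1 hm))).mul
    (analyticAt_one_sub ?_)
  rcases hm with hm | hm
  · refine hs.analytic_one _ ?_
    have : ‖s‖ ≤ 1 - ξ₁ := by simpa using hm
    simpa [dist_eq_norm] using this
  · exact hg _ (one_sub_mem_unitCut.2 (segment_subset_unitCut hb1.le hm))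

lemma IsSplitting.analyticOnNhd {g : ℂ → ℂ} {ξ₀ ξ₁ : ℝ} (hg : AnalyticOnNhd ℂ g unitCut)
    (hs : IsSplitting g ξ₀ ξ₁) (β : ℂ) {b : ℝ} (hb1 : b < 1) :
    AnalyticOnNhd ℂ (fun s => (1 - s) ^ β * g s) (diskSegment ξ₀ b) := by
  have h1 := hs.le
  have h2 := hs.lt_one
  intro s hm
  refine ((differentiableOn_one_sub_cpow β).analyticAt
    (isOpen_ball.mem_nhds (diskSegment_subset_ball (by linarith) hb1 hm))).mul ?_
  rcases hm with hm | hm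
  · exact hs.analytic_zero _ hm
  · exact hg _ (segment_subset_unitCut hb1.le hm)

lemma intervalIntegrable_weight (α β : ℂ) {g : ℂ → ℂ} (hg : AnalyticOnNhd ℂ g unitCut) {c d : ℝ}
    (hc : 0 < c) (hc1 : c < 1) (hd : 0 < d) (hd1 : d < 1) :
    IntervalIntegrable (fun t : ℝ => (t : ℂ) ^ α * (1 - (t : ℂ)) ^ β * g t)
      MeasureTheory.volume c d := by
  have hmem : ∀ t ∈ Set.uIcc c d, 0 < t ∧ t < 1 := fun t ht =>
    ⟨(lt_min hc hd).trans_le ht.1, ht.2.trans_lt (max_lt hc1 hd1)⟩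
  refine ContinuousOn.intervalIntegrable (((continuousOn_cpow_uIcc α hc hd).mul ?_).mul ?_)
  · exact (differentiableOn_one_sub_cpow β).continuousOn.comp
      Complex.continuous_ofReal.continuousOn fun t ht => by
        simpa [abs_of_pos (hmem t ht).1] using (hmem t ht).2
  · exact hg.continuousOn.comp Complex.continuous_ofReal.continuousOn fun t ht =>
      ⟨t, ⟨(hmem t ht).1.le, (hmem t ht).2.le⟩, rfl⟩

/-- Any `b` in `(0,1)` serves, inside `[ξ₀, ξ₁]` or not, since the integrals are oriented. Each
summand involves one splitting point only, so two splittings can be compared endpoint by endpoint.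
-/
lemma splitFinitePart_eq (α β : ℂ) {g : ℂ → ℂ} (hg : AnalyticOnNhd ℂ g unitCut) {ξ₀ ξ₁ : ℝ}
    (hs : IsSplitting g ξ₀ ξ₁) {b : ℝ} (hb : 0 < b) (hb1 : b < 1) :
    splitFinitePart α β g ξ₀ ξ₁ = fpTo (α + 1) (fun t => (1 - t) ^ β * g t) ξ₀ b +
      fpTo (β + 1) (fun s => (1 - s) ^ α * g (1 - s)) (1 - ξ₁) (1 - b) := by
  have h0 := hs.pos
  have h1 := hs.le
  have h2 := hs.lt_one
  have e1 : ∫ t in ξ₀..b, (t : ℂ) ^ (α + 1 - 1) * ((1 - (t : ℂ)) ^ β * g t) =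
      ∫ t in ξ₀..b, (t : ℂ) ^ α * (1 - (t : ℂ)) ^ β * g t := by
    simp only [add_sub_cancel_right, mul_assoc]
  have e2 : ∫ s in (1 - ξ₁)..(1 - b), (s : ℂ) ^ (β + 1 - 1) * ((1 - (s : ℂ)) ^ α * g (1 - s)) =
      ∫ t in b..ξ₁, (t : ℂ) ^ α * (1 - (t : ℂ)) ^ β * g t := by
    have h3 := intervalIntegral.integral_comp_sub_left (a := 1 - ξ₁) (b := 1 - b)
      (fun t : ℝ => (t : ℂ) ^ α * (1 - (t : ℂ)) ^ β * g t) 1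
    rw [sub_sub_cancel, sub_sub_cancel] at h3
    rw [← h3]
    refine intervalIntegral.integral_congr fun s _ => ?_
    simp only [add_sub_cancel_right]
    push_cast
    rw [sub_sub_cancel]
    ring
  rw [splitFinitePart, fpTo, fpTo, e1, e2, ← intervalIntegral.integral_add_adjacent_intervals
    (intervalIntegrable_weight α β hg h0 (by linarith) hb hb1)
    (intervalIntegrable_weight α β hg hb hb1 (by linarith) h2)]
  ring

lemma nat_add_ne_zero_of_ne {α : ℂ} (hα : ∀ n : ℕ, α ≠ -((n : ℂ) + 1)) (n : ℕ) :
    (n : ℂ) + (α + 1) ≠ 0 := fun h => hα n (by linear_combination h)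

lemma splitFinitePart_unique {α β : ℂ} (hα : ∀ n : ℕ, (n : ℂ) + (α + 1) ≠ 0)
    (hβ : ∀ n : ℕ, (n : ℂ) + (β + 1) ≠ 0) {g : ℂ → ℂ} (hg : AnalyticOnNhd ℂ g unitCut)
    {ξ₀ ξ₁ η₀ η₁ : ℝ} (hs : IsSplitting g ξ₀ ξ₁) (hs' : IsSplitting g η₀ η₁) :
    splitFinitePart α β g ξ₀ ξ₁ = splitFinitePart α β g η₀ η₁ := by
  have hb : (0 : ℝ) < 1 / 2 := by norm_num
  have hb1 : (1 / 2 : ℝ) < 1 := by norm_num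
  have hb2 : (1 : ℝ) - 1 / 2 = 1 / 2 := by norm_num
  rw [splitFinitePart_eq α β hg hs hb hb1, splitFinitePart_eq α β hg hs' hb hb1, hb2,
    fpTo_split_eq' hα hs.pos hs'.pos hb (hs.analyticOnNhd hg β hb1) (hs'.analyticOnNhd hg β hb1),
    fpTo_split_eq' hβ (sub_pos.2 hs.lt_one) (sub_pos.2 hs'.lt_one) hb
      (hs.analyticOnNhd_reflect hg α hb1) (hs'.analyticOnNhd_reflect hg α hb1)]

lemma analyticAt_cauchyKernel (p : Polynomial ℂ) {z t : ℂ} (h : t ≠ z) :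
    AnalyticAt ℂ (cauchyKernel p z) t :=
  (p.differentiable.analyticAt t).div (analyticAt_id.sub analyticAt_const) (sub_ne_zero.2 h)

lemma exists_isSplitting_cauchyKernel (p : Polynomial ℂ) {z : ℂ} (hz : z ∉ unitCut) :
    ∃ ξ₀ ξ₁ : ℝ, ξ₀ < ‖z‖ ∧ 1 - ξ₁ < ‖1 - z‖ ∧ IsSplitting (cauchyKernel p z) ξ₀ ξ₁ := by
  have h0 : 0 < ‖z‖ := norm_pos_iff.2 fun h => hz (h ▸ zero_mem_unitCut)
  have h1 : 0 < ‖1 - z‖ := norm_pos_iff.2 fun h => hz (sub_eq_zero.1 h ▸ one_mem_unitCut)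
  have e1 : min (1 / 2) (‖z‖ / 2) ≤ 1 / 2 := min_le_left _ _
  have e2 : min (1 / 2) (‖z‖ / 2) ≤ ‖z‖ / 2 := min_le_right _ _
  have e3 : min (1 / 2) (‖1 - z‖ / 2) ≤ 1 / 2 := min_le_left _ _
  have e4 : min (1 / 2) (‖1 - z‖ / 2) ≤ ‖1 - z‖ / 2 := min_le_right _ _
  have e5 : 0 < min (1 / 2) (‖z‖ / 2) := lt_min (by norm_num) (by positivity)
  have e6 : 0 < min (1 / 2) (‖1 - z‖ / 2) := lt_min (by norm_num) (by positivity)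
  -- Radii at most half the distance from `z` to the endpoint keep the pole outside; the cap `1 / 2`
  -- ensures `ξ₀ ≤ ξ₁`.
  refine ⟨min (1 / 2) (‖z‖ / 2), 1 - min (1 / 2) (‖1 - z‖ / 2), by linarith, by linarith,
    by linarith, by linarith, by linarith, fun t ht => analyticAt_cauchyKernel p ?_,
    fun t ht => analyticAt_cauchyKernel p ?_⟩
  · rintro rfl
    rw [mem_closedBall_zero_iff] at ht
    linarith
  · rintro rfl
    rw [mem_closedBall, dist_comm, dist_eq_norm] at ht
    linarith

lemma analyticOnNhd_cauchyKernel (p : Polynomial ℂ) {z : ℂ} (hz : z ∉ unitCut) :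
    AnalyticOnNhd ℂ (cauchyKernel p z) unitCut := fun _ ht =>
  analyticAt_cauchyKernel p fun h => hz (h ▸ ht)

lemma exists_isFinitePart_cauchyKernel {α β : ℂ} (hα : ∀ n : ℕ, (n : ℂ) + (α + 1) ≠ 0)
    (hβ : ∀ n : ℕ, (n : ℂ) + (β + 1) ≠ 0) (p : Polynomial ℂ) {z : ℂ} (hz : z ∉ unitCut) :
    ∃ I, IsFinitePart α β (cauchyKernel p z) I := by
  obtain ⟨ξ₀, ξ₁, -, -, hs⟩ := exists_isSplitting_cauchyKernel p hz
  have hg := analyticOnNhd_cauchyKernel p hz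
  exact ⟨_, hg, ⟨ξ₀, ξ₁, hs⟩, fun _ _ hs' => splitFinitePart_unique hα hβ hg hs' hs⟩

lemma isFinitePart_finitePart {α β : ℂ} {g : ℂ → ℂ} (h : ∃ I, IsFinitePart α β g I) :
    IsFinitePart α β g (finitePart α β g) := by
  rw [finitePart, dif_pos h]
  exact h.choose_spec

/-! ### The Cauchy transform solves the problem -/

/-- The density `(1 - t) ^ β * p t`, analytic at `0`. -/
noncomputable def density (β : ℂ) (p : Polynomial ℂ) (t : ℂ) : ℂ := (1 - t) ^ β * p.eval t

lemma differentiableOn_density (β : ℂ) (p : Polynomial ℂ) :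
    DifferentiableOn ℂ (density β p) (ball 0 1) :=
  (differentiableOn_one_sub_cpow β).mul p.differentiable.differentiableOn

/-- The polynomial `p (1 - t)`. -/
noncomputable def reflect (p : Polynomial ℂ) : Polynomial ℂ := p.comp (1 - Polynomial.X)

lemma eval_reflect (p : Polynomial ℂ) (t : ℂ) : (reflect p).eval t = p.eval (1 - t) := by
  simp [reflect, Polynomial.eval_comp]

lemma reflect_reflect (p : Polynomial ℂ) : reflect (reflect p) = p := by
  simp [reflect, Polynomial.comp_assoc]

/-- The minus sign comes from `t - z = -(s - (1 - z))` under `t = 1 - s`. Since `b` is free, it can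
be placed so that only one of the two terms is singular at a given point of the cut. -/
lemma finitePart_cauchyKernel {α β : ℂ} (hα : ∀ n : ℕ, (n : ℂ) + (α + 1) ≠ 0)
    (hβ : ∀ n : ℕ, (n : ℂ) + (β + 1) ≠ 0) (p : Polynomial ℂ) {b : ℝ} (hb : 0 < b) (hb1 : b < 1)
    {z : ℂ} (hz : z ∉ unitCut) :
    finitePart α β (cauchyKernel p z) = halfTransform (α + 1) (density β p) b z -
      halfTransform (β + 1) (density α (reflect p)) (1 - b) (1 - z) := by
  obtain ⟨ξ₀, ξ₁, h0, h1, hs⟩ := exists_isSplitting_cauchyKernel p hz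
  have hg := analyticOnNhd_cauchyKernel p hz
  have hle := hs.le
  have hlt := hs.lt_one
  have hpos := hs.pos
  have hz' : 1 - z ∉ Complex.ofReal '' Set.Icc 0 (1 - b) := fun h =>
    hz (one_sub_mem_unitCut.1 (segment_subset_unitCut (by linarith) h))
  rw [← (isFinitePart_finitePart (exists_isFinitePart_cauchyKernel hα hβ p hz)).eq_split _ _ hs,
    splitFinitePart_eq α β hg hs hb hb1,
    halfTransform_eq hα (differentiableOn_density β p) hb hb1
      (fun h => hz (segment_subset_unitCut hb1.le h)) hpos (by linarith) h0,
    halfTransform_eq hβ (differentiableOn_density α (reflect p)) (by linarith) (by linarith) hz'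
      (sub_pos.2 hlt) (by linarith) h1, sub_eq_add_neg (fpTo _ _ _ _),
    neg_eq_neg_one_mul (fpTo _ _ _ _), ← fpTo_const_mul]
  congr 2
  · ext t
    simp only [cauchyKernel, density, mul_div_assoc]
  · ext s
    simp only [cauchyKernel, density, eval_reflect]
    rw [show s - (1 - z) = -(1 - s - z) by ring, div_neg, mul_neg, neg_one_mul, neg_neg,
      mul_div_assoc]

lemma cauchyTransform_eq {α β : ℂ} (hα : ∀ n : ℕ, (n : ℂ) + (α + 1) ≠ 0)
    (hβ : ∀ n : ℕ, (n : ℂ) + (β + 1) ≠ 0) (p : Polynomial ℂ) {b : ℝ} (hb : 0 < b) (hb1 : b < 1)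
    {z : ℂ} (hz : z ∉ unitCut) :
    cauchyTransform α β p z = 1 / (2 * (Real.pi : ℂ) * Complex.I) *
      (halfTransform (α + 1) (density β p) b z -
        halfTransform (β + 1) (density α (reflect p)) (1 - b) (1 - z)) := by
  rw [cauchyTransform, finitePart_cauchyKernel hα hβ p hb hb1 hz]

/-- This symmetry reduces the endpoint 1 to the endpoint 0. -/
lemma cauchyTransform_one_sub {α β : ℂ} (hα : ∀ n : ℕ, (n : ℂ) + (α + 1) ≠ 0)
    (hβ : ∀ n : ℕ, (n : ℂ) + (β + 1) ≠ 0) (p : Polynomial ℂ) {z : ℂ} (hz : z ∉ unitCut) :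
    cauchyTransform β α (reflect p) (1 - z) = -cauchyTransform α β p z := by
  have hb : (0 : ℝ) < 1 / 2 := by norm_num
  have hb1 : (1 / 2 : ℝ) < 1 := by norm_num
  have hb2 : (1 : ℝ) - 1 / 2 = 1 / 2 := by norm_num
  rw [cauchyTransform_eq hα hβ p hb hb1 hz, cauchyTransform_eq hβ hα (reflect p) hb hb1
    (fun h => hz (one_sub_mem_unitCut.1 h)), hb2, reflect_reflect, sub_sub_cancel]
  ring

lemma tendsto_one_sub_cobounded :
    Tendsto (fun z : ℂ => 1 - z) (Bornology.cobounded ℂ) (Bornology.cobounded ℂ) := by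
  have h := (tendsto_add_const_cobounded (1 : ℂ)).comp (tendsto_neg_cobounded (E := ℂ))
  refine h.congr fun z => ?_
  simp only [Function.comp_apply]
  ring

lemma inv_one_sub_isBigO : (fun z : ℂ => (1 - z)⁻¹) =O[Bornology.cobounded ℂ] (fun z : ℂ => z⁻¹) := by
  refine IsBigO.of_bound 2 ?_
  filter_upwards [(hasBasis_cobounded_norm (E := ℂ)).mem_of_mem (i := 2) trivial] with z hz
  have hz : 2 ≤ ‖z‖ := hz
  have h1 := norm_sub_norm_le z 1
  rw [norm_sub_rev, norm_one] at h1
  rw [norm_inv, norm_inv, ← div_eq_mul_inv, ← inv_div]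
  exact inv_anti₀ (by linarith) (by linarith)

lemma tendsto_one_sub_nhdsWithin (w : ℂ) :
    Tendsto (fun z : ℂ => 1 - z) (𝓝[unitCutᶜ] w) (𝓝[unitCutᶜ] (1 - w)) := by
  refine tendsto_nhdsWithin_iff.2 ⟨?_, ?_⟩
  · exact (tendsto_const_nhds.sub tendsto_id).mono_left nhdsWithin_le_nhds
  · filter_upwards [self_mem_nhdsWithin] with z hz using fun h => hz (one_sub_mem_unitCut.1 h)

section CauchyTransform

variable {α β : ℂ}

lemma differentiableAt_halfTransform_one_sub (hβ : ∀ n : ℕ, (n : ℂ) + (β + 1) ≠ 0) {h : ℂ → ℂ}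
    (hh : DifferentiableOn ℂ h (ball 0 1)) {b : ℝ} (hb : 0 < b) (hb1 : b < 1) {z : ℂ}
    (hz : 1 - z ∉ Complex.ofReal '' Set.Icc 0 b) :
    DifferentiableAt ℂ (fun z => halfTransform (β + 1) h b (1 - z)) z :=
  ((differentiableOn_halfTransform hβ hh hb hb1).differentiableAt
    ((isClosed_segment _).isOpen_compl.mem_nhds hz)).comp z
    ((differentiableAt_const 1).sub differentiableAt_id)

lemma exists_cauchyTransform_sub_isBigO_zero (hα : ∀ n : ℕ, (n : ℂ) + (α + 1) ≠ 0)
    (hβ : ∀ n : ℕ, (n : ℂ) + (β + 1) ≠ 0) (p : Polynomial ℂ) (h0 : α = 0 → p.eval 0 = 0) :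
    ∃ f₀ : ℂ → ℂ, AnalyticAt ℂ f₀ 0 ∧
      (fun z => cauchyTransform α β p z - cutPow α z * f₀ z) =O[𝓝[unitCutᶜ] (0 : ℂ)]
        (fun _ => (1 : ℝ)) := by
  have hb : (0 : ℝ) < 1 / 2 := by norm_num
  have hb1 : (1 / 2 : ℝ) < 1 := by norm_num
  obtain ⟨f₀, hf₀, hO⟩ := exists_halfTransform_sub_isBigO hα (differentiableOn_density β p)
    (fun h => by simp [density, h0 h]) hb hb1
  have h1 : (1 : ℂ) - 0 ∉ Complex.ofReal '' Set.Icc 0 (1 - 1 / 2) := by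
    rintro ⟨t, ht, hte⟩
    have : t = 1 := by exact_mod_cast hte.trans (sub_zero 1)
    linarith [ht.2]
  have h2 := isBigO_one_of_continuousAt (differentiableAt_halfTransform_one_sub hβ
    (differentiableOn_density α (reflect p)) (by norm_num) (by norm_num) h1).continuousAt unitCutᶜ
  refine ⟨fun z => 1 / (2 * (Real.pi : ℂ) * Complex.I) * f₀ z, analyticAt_const.mul hf₀, ?_⟩
  refine ((hO.sub h2).const_mul_left (1 / (2 * (Real.pi : ℂ) * Complex.I))).congr' ?_ EventuallyEq.rfl
  filter_upwards [self_mem_nhdsWithin] with z hz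
  rw [cauchyTransform_eq hα hβ p hb hb1 hz]
  ring

lemma isSolution_cauchyTransform (hα : ∀ n : ℕ, (n : ℂ) + (α + 1) ≠ 0)
    (hβ : ∀ n : ℕ, (n : ℂ) + (β + 1) ≠ 0) (p : Polynomial ℂ) (h0 : α = 0 → p.eval 0 = 0)
    (h1 : β = 0 → p.eval 1 = 0) : IsSolution α β p (cauchyTransform α β p) where
  analytic := by
    refine DifferentiableOn.analyticOnNhd ?_ isClosed_unitCut.isOpen_compl
    have hb : (0 : ℝ) < 1 / 2 := by norm_num
    have hb1 : (1 / 2 : ℝ) < 1 := by norm_num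
    refine DifferentiableOn.congr (f := fun z => 1 / (2 * (Real.pi : ℂ) * Complex.I) *
      (halfTransform (α + 1) (density β p) (1 / 2) z -
        halfTransform (β + 1) (density α (reflect p)) (1 - 1 / 2) (1 - z))) (fun z hz => ?_)
      fun z hz => cauchyTransform_eq hα hβ p hb hb1 hz
    have hA := (differentiableOn_halfTransform hα (differentiableOn_density β p) hb
      hb1).differentiableAt ((isClosed_segment _).isOpen_compl.mem_nhds
        fun h => hz (segment_subset_unitCut hb1.le h))
    have hB := differentiableAt_halfTransform_one_sub hβ (differentiableOn_density α (reflect p))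
      (b := 1 - 1 / 2) (by norm_num) (by norm_num) (z := z)
      fun h => hz (one_sub_mem_unitCut.1 (segment_subset_unitCut (by norm_num) h))
    exact ((hA.sub hB).const_mul _).differentiableWithinAt
  jump := by
    intro x hx hx1
    -- With `b = (1 + x) / 2 > x`, the whole jump at `x` comes from the first term; the second is
    -- continuous there.
    have hb : 0 < (1 + x) / 2 := by linarith
    have hb1 : (1 + x) / 2 < 1 := by linarith
    obtain ⟨P, M, hP, hM, hPM⟩ := exists_jump_halfTransform hα (differentiableOn_density β p) hb1 hx
      (by linarith)
    have hxb : (1 : ℂ) - x ∉ Complex.ofReal '' Set.Icc 0 (1 - (1 + x) / 2) := by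
      rintro ⟨t, ht, hte⟩
      have : t = 1 - x := by exact_mod_cast hte
      linarith [ht.2]
    have hB := (differentiableAt_halfTransform_one_sub hβ (differentiableOn_density α (reflect p))
      (by linarith) (by linarith) hxb).continuousAt.tendsto
    have heq : ∀ z : ℂ, z.im ≠ 0 → 1 / (2 * (Real.pi : ℂ) * Complex.I) *
        (halfTransform (α + 1) (density β p) ((1 + x) / 2) z -
          halfTransform (β + 1) (density α (reflect p)) (1 - (1 + x) / 2) (1 - z)) =
        cauchyTransform α β p z := fun z hz =>
      (cauchyTransform_eq hα hβ p hb hb1 (notMem_segment_of_im_ne_zero hz _)).symm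
    refine ⟨_, _, ((hP.sub (hB.mono_left nhdsWithin_le_nhds)).const_mul
      (1 / (2 * (Real.pi : ℂ) * Complex.I))).congr' ?_,
      ((hM.sub (hB.mono_left nhdsWithin_le_nhds)).const_mul
        (1 / (2 * (Real.pi : ℂ) * Complex.I))).congr' ?_, ?_⟩
    · filter_upwards [self_mem_nhdsWithin] with z hz using heq z (ne_of_gt hz)
    · filter_upwards [self_mem_nhdsWithin] with z hz using heq z (ne_of_lt hz)
    · rw [hPM, density, add_sub_cancel_right]
      have := Complex.two_pi_I_ne_zero
      field_simp
      ring
  at_infinity := by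
    have hb : (0 : ℝ) < 1 / 2 := by norm_num
    have hb1 : (1 / 2 : ℝ) < 1 := by norm_num
    have hA := halfTransform_isBigO_inv hα (differentiableOn_density β p) hb hb1
    have hB := ((halfTransform_isBigO_inv hβ (differentiableOn_density α (reflect p))
      (b := 1 - 1 / 2) (by norm_num) (by norm_num)).comp_tendsto
        tendsto_one_sub_cobounded).trans inv_one_sub_isBigO
    refine ((hA.sub hB).const_mul_left (1 / (2 * (Real.pi : ℂ) * Complex.I))).congr' ?_
      EventuallyEq.rfl
    have hbdd : unitCutᶜ ∈ Bornology.cobounded ℂ :=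
      Bornology.isBounded_def.1 (isCompact_Icc.image Complex.continuous_ofReal).isBounded
    filter_upwards [hbdd] with z hz
    exact (cauchyTransform_eq hα hβ p hb hb1 hz).symm
  at_zero := exists_cauchyTransform_sub_isBigO_zero hα hβ p h0
  at_one := by
    obtain ⟨f₀, hf₀, hO⟩ := exists_cauchyTransform_sub_isBigO_zero hβ hα (reflect p)
      (fun h => by rw [eval_reflect, sub_zero]; exact h1 h)
    refine ⟨fun z => -f₀ (1 - z), (analyticAt_one_sub (by rwa [sub_self])).neg, ?_⟩
    have ht := tendsto_one_sub_nhdsWithin 1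
    rw [sub_self] at ht
    refine (hO.comp_tendsto ht).neg_left.congr' ?_ EventuallyEq.rfl
    filter_upwards [self_mem_nhdsWithin] with z hz
    rw [Function.comp_apply, cauchyTransform_one_sub hα hβ p hz]
    ring

end CauchyTransform

/-! ### Analytic continuation across the cut -/

/-- Painlevé's theorem for the real line: a continuous function on a disk which is holomorphic off
the real line is holomorphic. -/
lemma differentiableOn_ball_of_im_ne_zero {f : ℂ → ℂ} {c : ℂ} {r : ℝ}
    (hc : ContinuousOn f (ball c r)) (hd : ∀ z ∈ ball c r, z.im ≠ 0 → DifferentiableAt ℂ f z) :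
    DifferentiableOn ℂ f (ball c r) := by
  have hhalf : ∀ x₀ x₁ y₀ y₁ : ℝ, Set.uIcc x₀ x₁ ×ℂ Set.uIcc y₀ y₁ ⊆ ball c r →
      (0 : ℝ) ∉ Set.Ioo (min y₀ y₁) (max y₀ y₁) →
      (∫ x in x₀..x₁, f (x + y₀ * Complex.I)) - (∫ x in x₀..x₁, f (x + y₁ * Complex.I)) +
        Complex.I • (∫ y in y₀..y₁, f (x₁ + y * Complex.I)) -
        Complex.I • (∫ y in y₀..y₁, f (x₀ + y * Complex.I)) = 0 := by
    intro x₀ x₁ y₀ y₁ hsub h0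
    have h := Complex.integral_boundary_rect_eq_zero_of_continuousOn_of_differentiableOn f
      ⟨x₀, y₀⟩ ⟨x₁, y₁⟩ (hc.mono hsub) fun z hz =>
        (hd z (hsub ⟨Set.Ioo_subset_Icc_self hz.1, Set.Ioo_subset_Icc_self hz.2⟩)
          fun e => h0 (e ▸ hz.2)).differentiableWithinAt
    simpa using h
  refine (Complex.IsConservativeOn.isExactOn_ball hc fun z w hzw => ?_).differentiableOn isOpen_ball
  rw [← add_eq_zero_iff_eq_neg, Complex.wedgeIntegral_add_wedgeIntegral_eq]
  -- Morera: a rectangle meeting the real line is divided along it. Cauchy's theorem needs only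
  -- continuity up to the boundary of each half, and the two integrals along the real line cancel.
  by_cases h0 : (0 : ℝ) ∈ Set.uIcc z.im w.im
  · have hs1 : Set.uIcc z.im 0 ⊆ Set.uIcc z.im w.im := Set.uIcc_subset_uIcc_left h0
    have hs2 : Set.uIcc 0 w.im ⊆ Set.uIcc z.im w.im := Set.uIcc_subset_uIcc_right h0
    have hr1 : Set.uIcc z.re w.re ×ℂ Set.uIcc z.im 0 ⊆ ball c r := fun v hv =>
      hzw ⟨hv.1, hs1 hv.2⟩
    have hr2 : Set.uIcc z.re w.re ×ℂ Set.uIcc 0 w.im ⊆ ball c r := fun v hv =>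
      hzw ⟨hv.1, hs2 hv.2⟩
    have h1 := hhalf z.re w.re z.im 0 hr1 (by
      rcases le_total z.im 0 with h | h <;> simp [h])
    have h2 := hhalf z.re w.re 0 w.im hr2 (by
      rcases le_total w.im 0 with h | h <;> simp [h])
    have hi : ∀ x ∈ Set.uIcc z.re w.re, ∀ s ⊆ Set.uIcc z.im w.im,
        ContinuousOn (fun y : ℝ => f (x + y * Complex.I)) s := fun x hx s hs =>
      hc.comp (by fun_prop) fun y hy => hzw ⟨by simpa using hx, by simpa using hs hy⟩
    rw [← intervalIntegral.integral_add_adjacent_intervals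
        (hi w.re Set.right_mem_uIcc _ hs1).intervalIntegrable
        (hi w.re Set.right_mem_uIcc _ hs2).intervalIntegrable,
      ← intervalIntegral.integral_add_adjacent_intervals
        (hi z.re Set.left_mem_uIcc _ hs1).intervalIntegrable
        (hi z.re Set.left_mem_uIcc _ hs2).intervalIntegrable]
    simp only [smul_eq_mul] at h1 h2 ⊢
    linear_combination h1 + h2
  · exact hhalf z.re w.re z.im w.im hzw fun h => h0 ⟨h.1.le, h.2.le⟩

lemma closure_im_pos_mem (x : ℝ) : (x : ℂ) ∈ closure {z : ℂ | 0 < z.im} := by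
  rw [Complex.closure_setOfPred_lt_im]
  simp

lemma closure_im_neg_mem (x : ℝ) : (x : ℂ) ∈ closure {z : ℂ | z.im < 0} := by
  rw [Complex.closure_setOfPred_im_lt]
  simp

lemma mem_closure_im_ne_zero (z : ℂ) : z ∈ closure {z : ℂ | z.im ≠ 0} := by
  by_cases h : z.im = 0
  · have hz : z = (z.re : ℂ) := Complex.ext rfl (by simpa using h)
    rw [hz]
    exact closure_mono (fun w hw => ne_of_gt hw) (closure_im_pos_mem z.re)
  · exact subset_closure h

lemma extendFrom_eq_of_notMem_unitCut {D : ℂ → ℂ} (hD : AnalyticOnNhd ℂ D unitCutᶜ) {z : ℂ}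
    (hz : z ∉ unitCut) : extendFrom {z : ℂ | z.im ≠ 0} D z = D z :=
  extendFrom_eq (mem_closure_im_ne_zero z)
    ((hD z hz).continuousAt.tendsto.mono_left nhdsWithin_le_nhds)

/-- A function analytic off `[0,1]` without jump across `(0,1)` extends analytically. -/
lemma differentiableAt_extendFrom {D : ℂ → ℂ} (hD : AnalyticOnNhd ℂ D unitCutᶜ)
    (hlim : ∀ x : ℝ, 0 < x → x < 1 → ∃ L, Tendsto D (𝓝[{z : ℂ | z.im ≠ 0}] (x : ℂ)) (𝓝 L))
    {w : ℂ} (hw : w ∈ ({0, 1}ᶜ : Set ℂ)) :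
    DifferentiableAt ℂ (extendFrom {z : ℂ | z.im ≠ 0} D) w := by
  have hopen : IsOpen ({0, 1}ᶜ : Set ℂ) := (Set.toFinite _).isClosed.isOpen_compl
  obtain ⟨r, hr, hrw⟩ := Metric.isOpen_iff.1 hopen w hw
  have hcont : ContinuousOn (extendFrom {z : ℂ | z.im ≠ 0} D) ({0, 1}ᶜ : Set ℂ) := by
    refine continuousOn_extendFrom (fun z _ => mem_closure_im_ne_zero z) fun z hz => ?_
    by_cases hzc : z ∈ unitCut
    · obtain ⟨x, hx, rfl⟩ := hzc
      simp only [Set.mem_compl_iff, Set.mem_insert_iff, Set.mem_singleton_iff, not_or] at hz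
      exact hlim x (hx.1.lt_of_ne fun h => hz.1 (by simp [← h]))
        (hx.2.lt_of_ne fun h => hz.2 (by simp [h]))
    · exact ⟨_, (hD z hzc).continuousAt.tendsto.mono_left nhdsWithin_le_nhds⟩
  refine (differentiableOn_ball_of_im_ne_zero (hcont.mono hrw) fun z _ hz => ?_).differentiableAt
    (ball_mem_nhds w hr)
  have hzc : z ∈ unitCutᶜ := notMem_segment_of_im_ne_zero hz _
  refine (hD z hzc).differentiableAt.congr_of_eventuallyEq ?_
  filter_upwards [isClosed_unitCut.isOpen_compl.mem_nhds hzc] with v hv using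
    extendFrom_eq_of_notMem_unitCut hD hv

/-! ### Removability of the endpoint singularities -/

lemma tendsto_cutPow_im_pos (a : ℂ) {x : ℝ} (hx : 0 < x) :
    Tendsto (cutPow a) (𝓝[{z : ℂ | 0 < z.im}] (x : ℂ)) (𝓝 ((x : ℂ) ^ a)) := by
  have hlog : Tendsto (fun z : ℂ => Complex.log (-z)) (𝓝[{z : ℂ | 0 < z.im}] (x : ℂ))
      (𝓝 (Real.log ‖-(x : ℂ)‖ - Real.pi * Complex.I)) := by
    refine (Complex.tendsto_log_nhdsWithin_im_neg_of_re_neg_of_im_zero (z := -(x : ℂ))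
      (by simpa using hx) (by simp)).comp
      (tendsto_nhdsWithin_iff.2 ⟨tendsto_id.neg.mono_left nhdsWithin_le_nhds, ?_⟩)
    filter_upwards [self_mem_nhdsWithin] with z hz
    simpa using hz
  have h := ((hlog.add_const ((Real.pi : ℂ) * Complex.I)).const_mul a).cexp
  convert! h using 2
  rw [Complex.cpow_def_of_ne_zero (by exact_mod_cast hx.ne'), ← Complex.ofReal_log hx.le, norm_neg,
    Complex.norm_real, Real.norm_of_nonneg hx.le]
  ring_nf

lemma tendsto_cutPow_im_neg (a : ℂ) {x : ℝ} (hx : 0 < x) :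
    Tendsto (cutPow a) (𝓝[{z : ℂ | z.im < 0}] (x : ℂ))
      (𝓝 (Complex.exp (2 * Real.pi * Complex.I * a) * (x : ℂ) ^ a)) := by
  have hlog : Tendsto (fun z : ℂ => Complex.log (-z)) (𝓝[{z : ℂ | z.im < 0}] (x : ℂ))
      (𝓝 (Real.log ‖-(x : ℂ)‖ + Real.pi * Complex.I)) := by
    refine (Complex.tendsto_log_nhdsWithin_im_nonneg_of_re_neg_of_im_zero (z := -(x : ℂ))
      (by simpa using hx) (by simp)).comp
      (tendsto_nhdsWithin_iff.2 ⟨tendsto_id.neg.mono_left nhdsWithin_le_nhds, ?_⟩)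
    filter_upwards [self_mem_nhdsWithin] with z hz
    simpa using (show z.im < 0 from hz).le
  have h := ((hlog.add_const ((Real.pi : ℂ) * Complex.I)).const_mul a).cexp
  convert! h using 2
  rw [Complex.cpow_def_of_ne_zero (by exact_mod_cast hx.ne'), ← Complex.ofReal_log hx.le, norm_neg,
    Complex.norm_real, Real.norm_of_nonneg hx.le, ← Complex.exp_add]
  ring_nf

lemma norm_cutPow_le {a : ℂ} (ha : 0 ≤ a.re) {z : ℂ} (hz1 : ‖z‖ ≤ 1) :
    ‖cutPow a z‖ ≤ Real.exp (|a.im| * (2 * Real.pi)) := by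
  rw [cutPow, Complex.norm_exp, Real.exp_le_exp]
  have h1 : Real.log ‖z‖ ≤ 0 := Real.log_nonpos (norm_nonneg z) hz1
  have h2 : |Complex.arg (-z) + Real.pi| ≤ 2 * Real.pi := by
    refine (abs_add_le _ _).trans ?_
    rw [abs_of_pos Real.pi_pos]
    linarith [Complex.abs_arg_le_pi (-z)]
  have h3 : -(a.im * (Complex.arg (-z) + Real.pi)) ≤ |a.im| * (2 * Real.pi) := by
    refine (neg_le_abs _).trans ?_
    rw [abs_mul]
    gcongr
  have h4 := mul_nonpos_of_nonneg_of_nonpos ha h1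
  simp only [Complex.mul_re, Complex.add_re, Complex.add_im, Complex.log_re, Complex.log_im,
    norm_neg, Complex.ofReal_re, Complex.ofReal_im, Complex.I_re, Complex.I_im, Complex.mul_im,
    mul_zero, mul_one, sub_zero, add_zero]
  linarith

lemma pow_mul_cutPow (N : ℕ) (a : ℂ) {z : ℂ} (hz : z ≠ 0) :
    z ^ N * cutPow a z = cutPow (a + N) z := by
  rw [← cutPow_natCast N hz, cutPow, cutPow, cutPow, ← Complex.exp_add]
  ring_nf

/-- Trivial monodromy makes `α` an integer, and the negative ones are excluded by hypothesis. -/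
lemma exp_two_pi_mul_eq_one {α : ℂ} (hα : ∀ n : ℕ, (n : ℂ) + (α + 1) ≠ 0)
    (h : Complex.exp (2 * Real.pi * Complex.I * α) = 1) : ∃ m : ℕ, α = m := by
  obtain ⟨n, hn⟩ := Complex.exp_eq_one_iff.1 h
  have hαn : α = n := by
    have h1 := Complex.two_pi_I_ne_zero
    exact mul_left_cancel₀ h1 (by rw [hn]; ring)
  rcases n with m | m
  · exact ⟨m, by simpa using hαn⟩
  · exact (hα m (by rw [hαn]; push_cast; ring)).elim

lemma norm_le_of_norm_le_slitDisk {F : ℂ → ℂ} {r C : ℝ} (hF : ∀ z ∈ slitDisk r, ‖F z‖ ≤ C)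
    (hc : ∀ x : ℝ, 0 < x → x < r → ContinuousAt F x) {z : ℂ} (hz0 : z ≠ 0) (hz : ‖z‖ < r) :
    ‖F z‖ ≤ C := by
  have hzr : z ∈ ball (0 : ℂ) r := by simpa using hz
  by_cases h : z ∈ slitDisk r
  · exact hF z h
  · obtain ⟨x, hx, rfl⟩ := not_not.1 fun hn => h ((mem_slitDisk le_rfl hzr).2 hn)
    have hx0 : 0 < x := hx.1.lt_of_ne fun e => hz0 (by simp [← e])
    have hxr : x < r := by simpa [abs_of_pos hx0] using hz
    have : (𝓝[{z : ℂ | 0 < z.im}] (x : ℂ)).NeBot :=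
      mem_closure_iff_nhdsWithin_neBot.1 (closure_im_pos_mem x)
    have ht : Tendsto F (𝓝[{z : ℂ | 0 < z.im}] (x : ℂ)) (𝓝 (F x)) :=
      (hc x hx0 hxr).tendsto.mono_left nhdsWithin_le_nhds
    refine le_of_tendsto ht.norm ?_
    filter_upwards [self_mem_nhdsWithin, mem_nhdsWithin_of_mem_nhds (isOpen_ball.mem_nhds hzr)]
      with w hw hwr
    exact hF w ((mem_slitDisk le_rfl hwr).2 (notMem_segment_of_im_ne_zero (ne_of_gt hw) _))

/-- On the cut, the two boundary values of `z ^ α` bound a single-valued function. -/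
lemma exists_norm_le_on_cut {α : ℂ} (hα : ∀ n : ℕ, (n : ℂ) + (α + 1) ≠ 0) {E h : ℂ → ℂ} {r C H : ℝ}
    (hr1 : r ≤ 1) (hE : ∀ z ∈ slitDisk r, ‖E z - cutPow α z * h z‖ ≤ C)
    (hEc : ∀ x : ℝ, 0 < x → x < r → ContinuousAt E x)
    (hhc : ∀ x : ℝ, 0 < x → x < r → ContinuousAt h x)
    (hH : ∀ z ∈ ball (0 : ℂ) r, ‖h z‖ ≤ H) :
    ∃ B, ∀ x : ℝ, 0 < x → x < r → ‖E x‖ ≤ B := by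
  have hside : ∀ x : ℝ, 0 < x → x < r → ∀ (s : Set ℂ) (v : ℂ), (∀ z ∈ s, z.im ≠ 0) →
      (x : ℂ) ∈ closure s → Tendsto (cutPow α) (𝓝[s] (x : ℂ)) (𝓝 v) → ‖E x - v * h x‖ ≤ C := by
    intro x hx0 hxr s v hs hxs hv
    have : (𝓝[s] (x : ℂ)).NeBot := mem_closure_iff_nhdsWithin_neBot.1 hxs
    have hxb : (x : ℂ) ∈ ball (0 : ℂ) r := by simpa [abs_of_pos hx0] using hxr
    refine le_of_tendsto (((hEc x hx0 hxr).tendsto.mono_left nhdsWithin_le_nhds).sub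
      (hv.mul ((hhc x hx0 hxr).tendsto.mono_left nhdsWithin_le_nhds))).norm ?_
    filter_upwards [self_mem_nhdsWithin, mem_nhdsWithin_of_mem_nhds (isOpen_ball.mem_nhds hxb)]
      with w hw hwr
    exact hE w ((mem_slitDisk le_rfl hwr).2 (notMem_segment_of_im_ne_zero (hs w hw) _))
  have hpos : ∀ x : ℝ, 0 < x → x < r → ‖E x - (x : ℂ) ^ α * h x‖ ≤ C := fun x hx hxr =>
    hside x hx hxr _ _ (fun z hz => ne_of_gt hz) (closure_im_pos_mem x) (tendsto_cutPow_im_pos α hx)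
  have hneg : ∀ x : ℝ, 0 < x → x < r →
      ‖E x - Complex.exp (2 * Real.pi * Complex.I * α) * (x : ℂ) ^ α * h x‖ ≤ C := fun x hx hxr =>
    hside x hx hxr _ _ (fun z hz => ne_of_lt hz) (closure_im_neg_mem x) (tendsto_cutPow_im_neg α hx)
  set q := Complex.exp (2 * Real.pi * Complex.I * α) with hq
  suffices ∃ B', ∀ x : ℝ, 0 < x → x < r → ‖(x : ℂ) ^ α * h x‖ ≤ B' by
    obtain ⟨B', hB'⟩ := this
    refine ⟨C + B', fun x hx hxr => ?_⟩
    have h1 := norm_add_le (E x - (x : ℂ) ^ α * h x) ((x : ℂ) ^ α * h x)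
    rw [sub_add_cancel] at h1
    linarith [hpos x hx hxr, hB' x hx hxr]
  by_cases hq1 : q = 1
  · obtain ⟨m, rfl⟩ := exp_two_pi_mul_eq_one hα hq1
    refine ⟨1 * H, fun x hx hxr => ?_⟩
    rw [Complex.cpow_natCast, norm_mul, norm_pow, Complex.norm_real, Real.norm_of_nonneg hx.le]
    gcongr
    · exact pow_le_one₀ hx.le (hxr.le.trans hr1)
    · exact hH x (by simpa [abs_of_pos hx] using hxr)
  -- Subtracting the two one-sided estimates eliminates `E` and leaves `(q - 1) * x ^ α * h x`,
  -- bounded by `2C`.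
  · have hq0 : 0 < ‖q - 1‖ := norm_pos_iff.2 (sub_ne_zero.2 hq1)
    refine ⟨(C + C) / ‖q - 1‖, fun x hx hxr => ?_⟩
    rw [le_div_iff₀ hq0, ← norm_mul]
    have h1 := norm_sub_le (E x - (x : ℂ) ^ α * h x) (E x - q * (x : ℂ) ^ α * h x)
    have h2 : E x - (x : ℂ) ^ α * h x - (E x - q * (x : ℂ) ^ α * h x) =
        (x : ℂ) ^ α * h x * (q - 1) := by ring
    rw [h2] at h1
    linarith [hpos x hx hxr, hneg x hx hxr]

/-- Riemann's removable singularity theorem for `z ^ N * E z`, followed by division by `z ^ N`. -/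
lemma meromorphicAt_of_pow_mul_bounded {E : ℂ → ℂ} (N : ℕ) {r B : ℝ} (hr : 0 < r)
    (hd : ∀ z : ℂ, z ≠ 0 → ‖z‖ < r → DifferentiableAt ℂ E z)
    (hB : ∀ z : ℂ, z ≠ 0 → ‖z‖ < r → ‖z ^ N * E z‖ ≤ B) : MeromorphicAt E 0 := by
  have h1 := Complex.differentiableOn_update_limUnder_of_bddAbove (f := fun z : ℂ => z ^ N * E z)
    (ball_mem_nhds (0 : ℂ) hr) (fun z hz => ((differentiableAt_pow N).mul
      (hd z hz.2 (by simpa using hz.1))).differentiableWithinAt)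
    ⟨B, by rintro _ ⟨z, hz, rfl⟩; exact hB z hz.2 (by simpa using hz.1)⟩
  have h2 := (h1.analyticAt (ball_mem_nhds (0 : ℂ) hr)).meromorphicAt
  have h3 := h2.div ((analyticAt_id (𝕜 := ℂ) (z := 0)).pow N).meromorphicAt
  refine h3.congr ?_
  filter_upwards [self_mem_nhdsWithin] with z hz
  have hz' : z ≠ 0 := hz
  simp only [Pi.div_apply, Pi.pow_apply, id, Function.update_of_ne hz']
  field_simp

/-- Polynomial growth leaves at worst a pole at 0. A pole would force `‖E‖ → ∞` along the positive
reals too, where `exists_norm_le_on_cut` bounds `E`. -/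
lemma exists_tendsto_of_sub_cutPow_isBigO {α : ℂ} (hα : ∀ n : ℕ, (n : ℂ) + (α + 1) ≠ 0)
    {E h : ℂ → ℂ} (hE : ∀ᶠ z in 𝓝[≠] (0 : ℂ), DifferentiableAt ℂ E z) (hh : AnalyticAt ℂ h 0)
    (hO : (fun z => E z - cutPow α z * h z) =O[𝓝[unitCutᶜ] (0 : ℂ)] (fun _ => (1 : ℝ))) :
    ∃ c, Tendsto E (𝓝[≠] (0 : ℂ)) (𝓝 c) := by
  obtain ⟨C, hC⟩ := hO.bound
  rw [eventually_nhdsWithin_iff] at hC hE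
  have hhb : ∀ᶠ z in 𝓝 (0 : ℂ), ‖h z‖ ≤ ‖h 0‖ + 1 :=
    hh.continuousAt.norm.eventually_le_const (by simp)
  obtain ⟨r₀, hr₀, hr₀s⟩ := Metric.eventually_nhds_iff_ball.1
    (hC.and (hE.and (hhb.and hh.eventually_analyticAt)))
  set r := min r₀ 1 with hrdef
  have hr : 0 < r := lt_min hr₀ one_pos
  have hr1 : r ≤ 1 := min_le_right _ _
  have hball : ∀ z ∈ ball (0 : ℂ) r, z ∈ ball (0 : ℂ) r₀ := fun z hz =>
    ball_subset_ball (min_le_left _ _) hz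
  have hmem : ∀ z : ℂ, ‖z‖ < r → z ∈ ball (0 : ℂ) r := fun z hz => by simpa using hz
  have hmemx : ∀ x : ℝ, 0 < x → x < r → (x : ℂ) ∈ ball (0 : ℂ) r := fun x hx hxr => by
    simpa [abs_of_pos hx] using hxr
  have hx0 : ∀ x : ℝ, 0 < x → (x : ℂ) ≠ 0 := fun x hx => by exact_mod_cast hx.ne'
  have hEd : ∀ z : ℂ, z ≠ 0 → ‖z‖ < r → DifferentiableAt ℂ E z := fun z hz hzr =>
    (hr₀s z (hball z (hmem z hzr))).2.1 hz
  have hEc : ∀ x : ℝ, 0 < x → x < r → ContinuousAt E x := fun x hx hxr =>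
    ((hr₀s x (hball x (hmemx x hx hxr))).2.1 (hx0 x hx)).continuousAt
  have hhc : ∀ x : ℝ, 0 < x → x < r → ContinuousAt h x := fun x hx hxr =>
    (hr₀s x (hball x (hmemx x hx hxr))).2.2.2.continuousAt
  have hH : ∀ z ∈ ball (0 : ℂ) r, ‖h z‖ ≤ ‖h 0‖ + 1 := fun z hz => (hr₀s z (hball z hz)).2.2.1
  have hEh : ∀ z ∈ slitDisk r, ‖E z - cutPow α z * h z‖ ≤ C := fun z hz => by
    simpa using (hr₀s z (hball z hz.1)).1 ((mem_slitDisk hr1 hz.1).1 hz)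
  obtain ⟨B, hB⟩ := exists_norm_le_on_cut hα hr1 hEh hEc hhc hH
  -- Multiplying by `z ^ N` brings the real part of the exponent to at least 0, so that the power is
  -- bounded near 0.
  obtain ⟨N, hN⟩ := exists_nat_ge (-α.re)
  have hre : 0 ≤ (α + N).re := by
    rw [Complex.add_re, Complex.natCast_re]
    linarith
  have hmer : MeromorphicAt E 0 := by
    refine meromorphicAt_of_pow_mul_bounded N
      (B := 1 * C + Real.exp (|(α + N).im| * (2 * Real.pi)) * (‖h 0‖ + 1)) hr hEd
      fun z hz hzr => norm_le_of_norm_le_slitDisk (F := fun z => z ^ N * E z) (fun w hw => ?_)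
      (fun x hx hxr => (continuousAt_id.pow N).mul (hEc x hx hxr)) hz hzr
    have hw0 := ne_zero_of_mem_slitDisk hw
    have hw1 : ‖w‖ ≤ 1 := by
      have : ‖w‖ < r := by simpa using hw.1
      linarith
    have h1 : w ^ N * E w = w ^ N * (E w - cutPow α w * h w) + cutPow (α + N) w * h w := by
      rw [← pow_mul_cutPow N α hw0]
      ring
    simp only [h1]
    refine (norm_add_le _ _).trans ?_
    rw [norm_mul, norm_mul, norm_pow]
    have h2 := hEh w hw
    gcongr
    · exact pow_le_one₀ (norm_nonneg _) hw1
    · exact norm_cutPow_le hre hw1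
    · exact hH w hw.1
  refine (tendsto_nhds_iff_meromorphicOrderAt_nonneg hmer).2 (not_lt.1 fun hneg => ?_)
  have hcob := (tendsto_cobounded_iff_meromorphicOrderAt_neg hmer).2 hneg
  have hreal : Tendsto (fun x : ℝ => (x : ℂ)) (𝓝[>] (0 : ℝ)) (𝓝[≠] (0 : ℂ)) := by
    refine tendsto_nhdsWithin_iff.2 ⟨?_, ?_⟩
    · exact (Complex.continuous_ofReal.tendsto' 0 0 (by simp)).mono_left nhdsWithin_le_nhds
    · filter_upwards [self_mem_nhdsWithin] with x hx using hx0 x hx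
  have hnorm := tendsto_norm_cobounded_atTop.comp (hcob.comp hreal)
  obtain ⟨x, hxB, hx⟩ := ((hnorm.eventually_gt_atTop B).and
    (Ioo_mem_nhdsGT hr)).exists
  exact absurd (hB x hx.1 hx.2) (not_le.2 hxB)

/-! ### Liouville's theorem and uniqueness -/

/-- Liouville's theorem for a function with two removable singularities that vanishes at infinity. -/
lemma eq_zero_of_differentiableAt_compl_pair {E : ℂ → ℂ}
    (hd : ∀ z ∈ ({0, 1}ᶜ : Set ℂ), DifferentiableAt ℂ E z)
    (h0 : ∃ c, Tendsto E (𝓝[≠] (0 : ℂ)) (𝓝 c)) (h1 : ∃ c, Tendsto E (𝓝[≠] (1 : ℂ)) (𝓝 c))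
    (hinf : Tendsto E (Bornology.cobounded ℂ) (𝓝 0)) {z : ℂ} (hz : z ∈ ({0, 1}ᶜ : Set ℂ)) :
    E z = 0 := by
  have hopen : IsOpen ({0, 1}ᶜ : Set ℂ) := (Set.toFinite _).isClosed.isOpen_compl
  have hdense : Dense ({0, 1}ᶜ : Set ℂ) := (Set.toFinite _).countable.dense_compl ℝ
  have hc : Continuous (extendFrom ({0, 1}ᶜ : Set ℂ) E) := by
    refine continuous_extendFrom hdense fun x => ?_
    by_cases hx : x ∈ ({0, 1}ᶜ : Set ℂ)
    · exact ⟨_, (hd x hx).continuousAt.tendsto.mono_left nhdsWithin_le_nhds⟩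
    · rcases not_not.1 hx with rfl | rfl
      · exact h0.imp fun c hc => hc.mono_left (nhdsWithin_mono _ fun w hw => fun e => hw (by simp_all))
      · exact h1.imp fun c hc => hc.mono_left (nhdsWithin_mono _ fun w hw => fun e => hw (by simp_all))
  have heq : ∀ w ∈ ({0, 1}ᶜ : Set ℂ), extendFrom ({0, 1}ᶜ : Set ℂ) E w = E w := fun w hw =>
    extendFrom_eq (hdense w) ((hd w hw).continuousAt.tendsto.mono_left nhdsWithin_le_nhds)
  have hd' : ∀ w ∈ ({0, 1}ᶜ : Set ℂ),
      DifferentiableAt ℂ (extendFrom ({0, 1}ᶜ : Set ℂ) E) w := fun w hw => by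
    refine (hd w hw).congr_of_eventuallyEq ?_
    filter_upwards [hopen.mem_nhds hw] with v hv using heq v hv
  have hdiff : Differentiable ℂ (extendFrom ({0, 1}ᶜ : Set ℂ) E) := fun w => by
    -- The continuous extension is holomorphic off two points, hence entire.
    refine (Complex.analyticAt_of_differentiable_on_punctured_nhds_of_continuousAt ?_
      hc.continuousAt).differentiableAt
    have hfin : (({0, 1} : Set ℂ) \ {w})ᶜ ∈ 𝓝 w :=
      ((Set.toFinite _).subset Set.sdiff_subset).isClosed.isOpen_compl.mem_nhds (by simp)
    filter_upwards [self_mem_nhdsWithin, mem_nhdsWithin_of_mem_nhds hfin] with v hv hv'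
    exact hd' v fun hm => hv' ⟨hm, hv⟩
  rw [← heq z hz]
  refine hdiff.apply_eq_of_tendsto_cocompact z ?_
  rw [← cobounded_eq_cocompact]
  refine hinf.congr' ?_
  have hb : ({0, 1}ᶜ : Set ℂ) ∈ Bornology.cobounded ℂ :=
    Bornology.isBounded_def.1 (Set.toFinite _).isBounded
  filter_upwards [hb] with w hw using (heq w hw).symm

lemma eqOn_of_isSolution {α β : ℂ} (hα : ∀ n : ℕ, (n : ℂ) + (α + 1) ≠ 0)
    (hβ : ∀ n : ℕ, (n : ℂ) + (β + 1) ≠ 0) {p : Polynomial ℂ} {f g : ℂ → ℂ}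
    (hf : IsSolution α β p f) (hg : IsSolution α β p g) : Set.EqOn f g unitCutᶜ := by
  set D : ℂ → ℂ := fun z => f z - g z with hDdef
  have hD : AnalyticOnNhd ℂ D unitCutᶜ := hf.analytic.sub hg.analytic
  have hlim : ∀ x : ℝ, 0 < x → x < 1 →
      ∃ L, Tendsto D (𝓝[{z : ℂ | z.im ≠ 0}] (x : ℂ)) (𝓝 L) := by
    intro x hx hx1
    obtain ⟨fP, fM, h1, h2, h3⟩ := hf.jump x hx hx1
    obtain ⟨gP, gM, h4, h5, h6⟩ := hg.jump x hx hx1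
    have hset : {z : ℂ | z.im ≠ 0} = {z : ℂ | 0 < z.im} ∪ {z : ℂ | z.im < 0} := by
      ext z
      exact ne_iff_lt_or_gt.trans or_comm
    -- Both solutions have the same jump, so their difference has equal limits from above and below.
    refine ⟨fP - gP, ?_⟩
    rw [hset, nhdsWithin_union]
    refine (h1.sub h4).sup ?_
    have h7 : fP - gP = fM - gM := by rw [h3, h6]; ring
    rw [h7]
    exact h2.sub h5
  set E := extendFrom {z : ℂ | z.im ≠ 0} D
  have hE : ∀ w ∈ ({0, 1}ᶜ : Set ℂ), DifferentiableAt ℂ E w := fun w hw =>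
    differentiableAt_extendFrom hD hlim hw
  have hED : ∀ z ∈ unitCutᶜ, E z = D z := fun z hz => extendFrom_eq_of_notMem_unitCut hD hz
  have hzero : ∃ c, Tendsto E (𝓝[≠] (0 : ℂ)) (𝓝 c) := by
    obtain ⟨f₀, hf₀, hfO⟩ := hf.at_zero
    obtain ⟨g₀, hg₀, hgO⟩ := hg.at_zero
    refine exists_tendsto_of_sub_cutPow_isBigO hα ?_ (hf₀.sub hg₀)
      ((hfO.sub hgO).congr' ?_ EventuallyEq.rfl)
    · filter_upwards [self_mem_nhdsWithin, mem_nhdsWithin_of_mem_nhds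
        (isOpen_compl_singleton.mem_nhds (zero_ne_one (α := ℂ)))] with z hz hz1
      exact hE z (by simp only [Set.mem_compl_iff, Set.mem_insert_iff]; exact not_or.2 ⟨hz, hz1⟩)
    · filter_upwards [self_mem_nhdsWithin] with z hz
      rw [hED z hz, Pi.sub_apply]
      ring
  have hone : ∃ c, Tendsto E (𝓝[≠] (1 : ℂ)) (𝓝 c) := by
    obtain ⟨f₁, hf₁, hfO⟩ := hf.at_one
    obtain ⟨g₁, hg₁, hgO⟩ := hg.at_one
    have hsub0 : Tendsto (fun z : ℂ => 1 - z) (𝓝[unitCutᶜ] 0) (𝓝[unitCutᶜ] 1) := by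
      simpa using tendsto_one_sub_nhdsWithin 0
    -- The result at 0 is applied to `z ↦ E (1 - z)` with exponent `β`.
    obtain ⟨c, hc⟩ := exists_tendsto_of_sub_cutPow_isBigO hβ (E := fun z => E (1 - z))
      (h := fun z => f₁ (1 - z) - g₁ (1 - z)) (by
        filter_upwards [self_mem_nhdsWithin, mem_nhdsWithin_of_mem_nhds
          (isOpen_compl_singleton.mem_nhds (zero_ne_one (α := ℂ)))] with z hz hz1
        have hz : z ≠ 0 := hz
        have hz1 : z ≠ 1 := hz1
        refine (hE (1 - z) ?_).comp z ((differentiableAt_const 1).sub differentiableAt_id)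
        rintro (h | h)
        · exact hz1 (sub_eq_zero.1 h).symm
        · exact hz (sub_eq_self.1 h))
      ((analyticAt_one_sub (by rwa [sub_zero])).sub (analyticAt_one_sub (by rwa [sub_zero])))
      (((hfO.sub hgO).comp_tendsto hsub0).congr' (by
        filter_upwards [self_mem_nhdsWithin] with z hz
        rw [hED _ fun h => hz (one_sub_mem_unitCut.1 h)]
        simp only [Function.comp_apply, sub_sub_cancel, hDdef]
        ring) EventuallyEq.rfl)
    have hsub1 : Tendsto (fun z : ℂ => 1 - z) (𝓝[≠] 1) (𝓝[≠] 0) := by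
      refine tendsto_nhdsWithin_iff.2 ⟨?_, ?_⟩
      · have h1 : ContinuousAt (fun z : ℂ => 1 - z) 1 := by fun_prop
        simpa [ContinuousAt] using h1.tendsto.mono_left nhdsWithin_le_nhds
      · filter_upwards [self_mem_nhdsWithin] with z hz using fun h => hz (sub_eq_zero.1 h).symm
    exact ⟨c, by simpa [Function.comp_def] using hc.comp hsub1⟩
  have hinf : Tendsto E (Bornology.cobounded ℂ) (𝓝 0) := by
    refine ((hf.at_infinity.sub hg.at_infinity).trans_tendsto tendsto_inv₀_cobounded).congr' ?_
    have hb : unitCutᶜ ∈ Bornology.cobounded ℂ :=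
      Bornology.isBounded_def.1 (isCompact_Icc.image Complex.continuous_ofReal).isBounded
    filter_upwards [hb] with z hz using (hED z hz).symm
  intro z hz
  have h1 := eq_zero_of_differentiableAt_compl_pair hE hzero hone hinf (z := z) (by
    rintro (rfl | rfl)
    · exact hz zero_mem_unitCut
    · exact hz one_mem_unitCut)
  rw [hED z hz] at h1
  exact sub_eq_zero.1 h1

end JacobiRH

theorem theorem2p5 (α β : ℂ) (p : Polynomial ℂ)
    (hα : ∀ n : ℕ, α ≠ -((n : ℂ) + 1)) (hβ : ∀ n : ℕ, β ≠ -((n : ℂ) + 1)) :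
    -- the finite part defining the Cauchy transform is well defined, whatever the splitting points
    (∀ z ∈ JacobiRH.unitCutᶜ, JacobiRH.IsFinitePart α β (JacobiRH.cauchyKernel p z)
      (JacobiRH.finitePart α β (JacobiRH.cauchyKernel p z))) ∧
    -- there is at most one solution
    (∀ f g : ℂ → ℂ, JacobiRH.IsSolution α β p f → JacobiRH.IsSolution α β p g →
      Set.EqOn f g JacobiRH.unitCutᶜ) ∧
    -- the Cauchy transform is a solution, unless it has a logarithmic singularity at an endpoint
    ((α = 0 → p.eval 0 = 0) → (β = 0 → p.eval 1 = 0) →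
      JacobiRH.IsSolution α β p (JacobiRH.cauchyTransform α β p)) := by
  have hα' := JacobiRH.nat_add_ne_zero_of_ne hα
  have hβ' := JacobiRH.nat_add_ne_zero_of_ne hβ
  refine ⟨fun z hz => ?_, fun f g hf hg => ?_, fun h0 h1 => ?_⟩
  · exact JacobiRH.isFinitePart_finitePart (JacobiRH.exists_isFinitePart_cauchyKernel hα' hβ' p hz)
  · exact JacobiRH.eqOn_of_isSolution hα' hβ' hf hg
  · exact JacobiRH.isSolution_cauchyTransform hα' hβ' p h0 h1
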